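/- Fix an integer $d\ge 3$ and real constants $a\ge b>0$, and put $$\alpha=(d-1)\,\frac{a+(2^{d-1}-1)b}{2^{d-1}},\qquad p_n=\frac{a}{\binom{n}{d-1}},\qquad q_n=\frac{b}{\binom{n}{d-1}} .$$ *The random hypergraph.* The hypergraph stochastic block model $\mathcal H_n$ (for $n$ large enough that $p_n\le 1$) is the law of a pair $(H,\sigma)$, where $\sigma=(\sigma_1,\dots,\sigma_n)$ has i.i.d. entries uniform on $\{-1,+1\}$ and, given $\sigma$, $H$ is the random $d$-uniform hypergraph on $[n]$ which contains each $d$-element set $e\subseteq[n]$ as a hyperedge independently, with probability $p_n$ if $\sigma$ is constant on $e$ and with probability $q_n$ otherwise. *The hypertree.* For $s\in\{-1,+1\}$ let $(T,\rho,\tau^{s})$ be the following multi-type Poisson Galton–Watson hypertree. The root $\rho$ has spin $s$. Every vertex $v$, independently of all other vertices, generates $\mathrm{Pois}\left(\frac{\alpha}{d-1}\right)$ hyperedges, each consisting of $v$ and $d-1$ new vertices (children of $v$). Each of these hyperedges independently receives a type, which is $d-1$ with probability $\frac{(d-1)a}{\alpha 2^{d-1}}$ and $r$ with probability $\frac{(d-1)b\binom{d-1}{r}}{\alpha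 2^{d-1}}$ for $0\le r\le d-2$. In a hyperedge of type $r$, a uniformly chosen set of $r$ children receives the spin of $v$, and the other $d-1-r$ children receive the opposite spin. *Truncation and isomorphism.* A walk of length $k$ is a sequence $(i_0,e_1,i_1,\dots,e_k,i_k)$ of vertices and hyperedges with $i_{j-1}\ne i_j$ and $\{i_{j-1},i_j\}\subseteq e_j$ for all $j$. The distance of two vertices is the minimal length of a walk between them. For a rooted hypergraph with spins, the subscript $l$ denotes the rooted sub-hypergraph, with spins, induced on the vertices at distance at most $l$ from the root. We write $\equiv$ for the existence of a bijection between the vertex sets that maps root to root, maps hyperedges to hyperedges in both directions, and preserves spins. **Theorem.** Let $c\ge 0$ be a constant with $c\log\alpha<\frac14$, and let $l=c\log n$. Then for all sufficiently large $n$ (depending only on $a,b,d,c$), every vertex $i\in[n]$ and every $s\in\{-1,+1\}$, there is a coupling of the law of $(H,\sigma)\sim\mathcal H_n$ conditioned on $\sigma_i=s$ with the hypertree $(T,\rho,\tau^{s})$ such that, with probability at least $1-n^{-1/5}$, $$(H,i,\sigma)_l\equiv(T,\rho,\tau^{s})_l .$$ -/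

import Mathlib

open MeasureTheory ProbabilityTheory Filter

/-! ### Hypergraphs, distance, truncation, spin-preserving isomorphism -/

/-- `HasWalk H u v k`: there is a walk `(i₀, e₁, i₁, …, e_k, i_k)` of length `k` in `H` from
`u = i₀` to `v = i_k`, i.e. `i_{j-1} ≠ i_j` and `{i_{j-1}, i_j} ⊆ e_j` for all `j`. -/
inductive HasWalk {V : Type*} (H : Hypergraph V) : V → V → ℕ → Prop
  | nil {u : V} (hu : u ∈ H.vertexSet) : HasWalk H u u 0
  | cons {u v w : V} {k : ℕ} {e : Set V} (he : e ∈ H.edgeSet) (huv : u ≠ v) (hu : u ∈ e)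
      (hv : v ∈ e) (hw : HasWalk H v w k) : HasWalk H u w (k + 1)

/-- The distance of two vertices: the minimal length of a walk between them
(`⊤` if there is none). -/
noncomputable def hyperDist {V : Type*} (H : Hypergraph V) (u v : V) : ℕ∞ :=
  sInf {m : ℕ∞ | ∃ k : ℕ, HasWalk H u v k ∧ m = k}

/-- A rooted hypergraph with a spin in `{-1, +1} = ℤˣ` at each vertex
(the values of `spin` outside the vertex set are irrelevant). -/
structure RootedSpinHypergraph (V : Type*) where
  graph : Hypergraph V
  root : V
  root_mem : root ∈ graph.vertexSet
  spin : V → ℤˣ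

/-- The truncation `(H, i, σ)_t` at distance `t` from the root: the sub-hypergraph induced on the
vertices at distance at most `t` from the root, with the same root and the same spins. -/
def RootedSpinHypergraph.truncate {V : Type*} (X : RootedSpinHypergraph V) (t : ℕ) :
    RootedSpinHypergraph V where
  graph :=
    { vertexSet := {v | v ∈ X.graph.vertexSet ∧ hyperDist X.graph X.root v ≤ t}
      edgeSet := {e | e ∈ X.graph.edgeSet ∧
        ∀ v ∈ e, v ∈ X.graph.vertexSet ∧ hyperDist X.graph X.root v ≤ t}
      subset_vertexSet_of_mem_edgeSet' := fun _ he v hv => he.2 v hv }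
  root := X.root
  root_mem := ⟨X.root_mem,
    (sInf_le ⟨0, HasWalk.nil X.root_mem, rfl⟩ : hyperDist X.graph X.root X.root ≤ (0 : ℕ)).trans
      (by simp)⟩
  spin := X.spin

/-- Spin-preserving isomorphism `(H, i, σ) ≡ (H', i', σ')`: a bijection of the vertex sets which
maps root to root, for which `e` is a hyperedge iff `φ(e)` is, and which preserves the spins. -/
def SpinIso {V V' : Type*} (X : RootedSpinHypergraph V) (Y : RootedSpinHypergraph V') : Prop :=
  ∃ φ : X.graph.vertexSet ≃ Y.graph.vertexSet,
    φ ⟨X.root, X.root_mem⟩ = ⟨Y.root, Y.root_mem⟩ ∧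
    (∀ e : Set X.graph.vertexSet,
      Subtype.val '' e ∈ X.graph.edgeSet ↔ Subtype.val '' (φ '' e) ∈ Y.graph.edgeSet) ∧
    ∀ v : X.graph.vertexSet, X.spin v = Y.spin (φ v)

/-! ### Parameters -/

/-- The constants of the model: `d ≥ 3` and `a ≥ b > 0`. -/
structure HSBMParams where
  d : ℕ
  a : ℝ
  b : ℝ
  three_le_d : 3 ≤ d
  b_pos : 0 < b
  b_le_a : b ≤ a

namespace HSBMParams

/-- `α = (d - 1) (a + (2^{d-1} - 1) b) / 2^{d-1}`. -/
noncomputable def alpha (P : HSBMParams) : ℝ :=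
  ((P.d : ℝ) - 1) * ((P.a + (2 ^ (P.d - 1) - 1) * P.b) / 2 ^ (P.d - 1))

theorem alpha_pos (P : HSBMParams) : 0 < P.alpha := by
  have h3 : (3 : ℝ) ≤ P.d := by exact_mod_cast P.three_le_d
  have ha : 0 < P.a := P.b_pos.trans_le P.b_le_a
  have h2 : (1 : ℝ) ≤ 2 ^ (P.d - 1) := one_le_pow₀ (by norm_num)
  have h4 : 0 ≤ ((2 : ℝ) ^ (P.d - 1) - 1) * P.b := mul_nonneg (by linarith) P.b_pos.le
  have h5 : (0 : ℝ) < P.d - 1 := by linarith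
  unfold alpha
  positivity

/-! ### The hypergraph stochastic block model `H(n, d, p_n, q_n)` -/

/-- The potential hyperedges: the `d`-element subsets of the vertex set `[n]`. -/
abbrev PotentialEdge (P : HSBMParams) (n : ℕ) : Type :=
  {e : Finset (Fin n) // e.card = P.d}

/-- The sample space of pairs `(H, σ)`: a `d`-uniform hypergraph `H` on `[n]`, given by the
indicators of its hyperedges, and spins `σ`. -/
abbrev Sample (P : HSBMParams) (n : ℕ) : Type :=
  (P.PotentialEdge n → Bool) × (Fin n → ℤˣ)

/-- The inclusion probability of the hyperedge `e` given the spins: `p_n = a / (n choose d-1)` if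
all spins on `e` agree and `q_n = b / (n choose d-1)` otherwise. For the finitely many `n` where
this number exceeds `1` it is replaced by `1`. -/
noncomputable def edgeProb (P : HSBMParams) (n : ℕ) (σ : Fin n → ℤˣ) (e : P.PotentialEdge n) :
    unitInterval :=
  open scoped Classical in
  Set.projIcc (0 : ℝ) 1 zero_le_one
    ((if ∀ x ∈ e.1, ∀ y ∈ e.1, σ x = σ y then P.a else P.b) / (n.choose (P.d - 1) : ℝ))

/-- The law of the spins: independent and uniform on `{-1, +1}`. -/
noncomputable def spinLaw (n : ℕ) : Measure (Fin n → ℤˣ) :=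
  Measure.pi fun _ => (PMF.uniformOfFintype ℤˣ).toMeasure

/-- The conditional law of `H` given the spins: the hyperedges are included independently. -/
noncomputable def edgeLaw (P : HSBMParams) (n : ℕ) (σ : Fin n → ℤˣ) :
    Measure (P.PotentialEdge n → Bool) :=
  Measure.pi fun e => bernoulliMeasure true false (P.edgeProb n σ e)

/-- The law `H(n, d, p_n, q_n)` of the pair `(H, σ)`. -/
noncomputable def hsbmLaw (P : HSBMParams) (n : ℕ) : Measure (P.Sample n) :=
  ∑ σ : Fin n → ℤˣ, (spinLaw n {σ}) • (P.edgeLaw n σ).map fun T => (T, σ)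

/-- The rooted hypergraph with spins `(H, i, σ)`. -/
def sampleGraph (P : HSBMParams) {n : ℕ} (x : P.Sample n) (i : Fin n) :
    RootedSpinHypergraph (Fin n) where
  graph :=
    { vertexSet := Set.univ
      edgeSet := {e | ∃ f : P.PotentialEdge n, x.1 f = true ∧ e = (f.1 : Set (Fin n))}
      subset_vertexSet_of_mem_edgeSet' := fun _ _ => Set.subset_univ _ }
  root := i
  root_mem := Set.mem_univ i
  spin := x.2

/-! ### The multi-type Poisson Galton–Watson hypertree -/

/-- The probability that a hyperedge is of type `r`, `0 ≤ r ≤ d - 1`. -/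
noncomputable def typeProb (P : HSBMParams) (r : Fin P.d) : ℝ :=
  if (r : ℕ) = P.d - 1 then ((P.d : ℝ) - 1) * P.a / (P.alpha * 2 ^ (P.d - 1))
  else ((P.d : ℝ) - 1) * P.b * ((P.d - 1).choose r : ℝ) / (P.alpha * 2 ^ (P.d - 1))

theorem typeProb_nonneg (P : HSBMParams) (r : Fin P.d) : 0 ≤ P.typeProb r := by
  have h3 : (3 : ℝ) ≤ P.d := by exact_mod_cast P.three_le_d
  have hd : (0 : ℝ) ≤ P.d - 1 := by linarith
  have hb := P.b_pos.le
  have ha : 0 ≤ P.a := hb.trans P.b_le_a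
  have hα := P.alpha_pos.le
  unfold typeProb
  split_ifs <;> positivity

theorem sum_typeProb (P : HSBMParams) : ∑ r, P.typeProb r = 1 := by
  obtain ⟨m, hm⟩ : ∃ m, P.d = m + 1 := ⟨P.d - 1, by have := P.three_le_d; omega⟩
  have h3 : (3 : ℝ) ≤ P.d := by exact_mod_cast P.three_le_d
  have hα := P.alpha_pos
  have hsum : ∑ r : Fin P.d, P.typeProb r = ∑ r ∈ Finset.range P.d,
      (if r = P.d - 1 then ((P.d : ℝ) - 1) * P.a / (P.alpha * 2 ^ (P.d - 1))
       else ((P.d : ℝ) - 1) * P.b * ((P.d - 1).choose r : ℝ) / (P.alpha * 2 ^ (P.d - 1))) := by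
    rw [Finset.sum_range]; rfl
  have hchoose : ∑ r ∈ Finset.range m, (m.choose r : ℝ) = 2 ^ m - 1 := by
    have h := Nat.sum_range_choose m
    rw [Finset.sum_range_succ, Nat.choose_self] at h
    have h' : (∑ r ∈ Finset.range m, (m.choose r : ℝ)) + 1 = 2 ^ m := by exact_mod_cast h
    linarith
  rw [hsum, hm, Finset.sum_range_succ, Nat.add_sub_cancel, if_pos rfl]
  rw [Finset.sum_congr rfl (fun r hr => if_neg (Finset.mem_range.1 hr).ne)]
  rw [← Finset.sum_div, ← Finset.mul_sum, hchoose]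
  have hαe : P.alpha * 2 ^ m = ((m + 1 : ℕ) - 1 : ℝ) * (P.a + (2 ^ m - 1) * P.b) := by
    unfold alpha
    rw [hm, Nat.add_sub_cancel]
    field_simp
  have hne : P.alpha * 2 ^ m ≠ 0 := by positivity
  rw [← add_div, div_eq_one_iff_eq hne, hαe]
  ring

/-- The law of the type of a hyperedge. -/
noncomputable def typeLaw (P : HSBMParams) : PMF (Fin P.d) :=
  PMF.ofFintype (fun r => ENNReal.ofReal (P.typeProb r)) (by
    rw [← ENNReal.ofReal_sum_of_nonneg fun r _ => P.typeProb_nonneg r, sum_typeProb,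
      ENNReal.ofReal_one])

/-- The law of the set of those among the `d - 1` children of a hyperedge which have the spin of
their parent: first draw the type `r`, then choose `r` of the children uniformly. -/
noncomputable def agreeLaw (P : HSBMParams) : PMF (Finset (Fin (P.d - 1))) :=
  P.typeLaw.bind fun r =>
    PMF.uniformOfFinset (Finset.powersetCard (r : ℕ) Finset.univ)
      (Finset.powersetCard_nonempty.2 (by
        rw [Finset.card_univ, Fintype.card_fin]; exact Nat.le_sub_one_of_lt r.2))

/-- Labels of possible vertices of the hypertree: `[]` is the root, and `(k, j) :: v` is the `j`-th
child of `v` in the `k`-th hyperedge generated by `v`. -/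
abbrev Address (P : HSBMParams) : Type := List (ℕ × Fin (P.d - 1))

/-- The randomness of the growth process: for each `v` the number of hyperedges which `v`
generates, and for its `k`-th hyperedge the set of the children with the spin of `v`. -/
abbrev Growth (P : HSBMParams) : Type :=
  P.Address → ℕ × (ℕ → Finset (Fin (P.d - 1)))

/-- The law of the growth process: all vertices generate independently, each of them
`Pois(α / (d - 1))` hyperedges, whose sets of agreeing children are i.i.d. -/
noncomputable def growthLaw (P : HSBMParams) : Measure P.Growth :=
  Measure.infinitePi fun _ : P.Address =>
    (poissonMeasure (P.alpha / ((P.d : ℝ) - 1)).toNNReal).prod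
      (Measure.infinitePi fun _ : ℕ => P.agreeLaw.toMeasure)

/-- The vertices which are present in the hypertree. -/
def present (P : HSBMParams) (ω : P.Growth) : P.Address → Prop
  | [] => True
  | (k, _) :: v => P.present ω v ∧ k < (ω v).1

/-- The spins on the hypertree whose root has spin `s`. -/
def treeSpin (P : HSBMParams) (s : ℤˣ) (ω : P.Growth) : P.Address → ℤˣ
  | [] => s
  | (k, j) :: v => if j ∈ (ω v).2 k then P.treeSpin s ω v else -P.treeSpin s ω v

/-- The multi-type Galton–Watson hypertree with root spin `s`: `(T, ρ, τ)` for `s = 1` and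
`(T, ρ, -τ)` for `s = -1`. The hyperedges generated by `v` consist of `v` and `d - 1` children. -/
def treeGraph (P : HSBMParams) (s : ℤˣ) (ω : P.Growth) : RootedSpinHypergraph P.Address where
  graph :=
    { vertexSet := {v | P.present ω v}
      edgeSet := {e | ∃ v k, P.present ω v ∧ k < (ω v).1 ∧
        e = insert v (Set.range fun j : Fin (P.d - 1) => ((k, j) :: v : P.Address))}
      subset_vertexSet_of_mem_edgeSet' := by
        rintro e ⟨v, k, hv, hk, rfl⟩ w hw
        rcases hw with rfl | ⟨j, rfl⟩
        · exact hv
        · exact ⟨hv, hk⟩ }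
  root := []
  root_mem := trivial
  spin := P.treeSpin s ω

end HSBMParams

/-- `π` is a coupling of `μ` and `ν`: its marginals are `μ` and `ν`. -/
def IsCoupling {X Y : Type*} [MeasurableSpace X] [MeasurableSpace Y]
    (π : Measure (X × Y)) (μ : Measure X) (ν : Measure Y) : Prop :=
  π.map Prod.fst = μ ∧ π.map Prod.snd = ν

/-! The law of the neighbourhood of `i` and the law of the hypertree are compared class by class. A
class (`growthClass`) consists of all growths that agree at every vertex of depth less than `l`. Its
counterpart in the hypergraph is `labelEvent`: the ball around `i` is a copy of the truncated tree,
with labels sorted among siblings. Sorting picks one labelling out of each family of reorderings, so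
a hypergraph determines both the class and the labels (`Embeds.unique`), and events of different
classes are disjoint. Each event yields the isomorphism (`Embeds.spinIso`). By
`exists_isCoupling_of_classes` it remains to prove a one-sided bound: the event has at least the
probability of its class, up to a small relative error.

Let the tree have V vertices, I of them interior, and E hyperedges, so V - 1 = (d-1)E, and put C = n
choose (d-1). The class has an explicit product probability (`growthLaw_growthClass`), in which the
powers of the Poisson mean cancel. In the hypergraph, a fixed labelling embeds the tree if the V - 1
spins other than the root's are right, which costs 2^{-(d-1)E}; if the E hyperedges are present,
each with probability a/C or b/C; and if every other hyperedge that meets an interior label or lies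
inside the label set is absent. After averaging over the free spins, Jensen's inequality bounds the
absence probability below by exp(-`edgeMean`·I - O(V²/n)) (`sum_sum_edgeProb_le`,
`le_condLaw_embeds`). Nearly n^{(d-1)E} labellings, divided by the number of sibling reorderings,
are available, and (d-1)!·C ≤ n^{d-1}. The two probabilities therefore match up to a relative error
O(V²/n) (`growthLaw_growthClass_le`).

The error is also trivially at most 1, and min(1, KV²/n) ≤ (1/M + KM/n)·V for every cutoff M. Hence
only the mean of V is needed, which is the sum of α^m over m ≤ l (`lintegral_card_nodeFin`). At
depth c log n with c log α < 1/4, the choice M = n^{9/20} gives the stated bound. -/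

open scoped ENNReal

/-! ### Couplings from a partial coupling and from a comparison of classes -/

/-- A measure whose marginals are dominated by two probability measures is dominated by a
coupling of them. -/
theorem exists_isCoupling_ge {X Y : Type*} [MeasurableSpace X] [MeasurableSpace Y]
    (μ : Measure X) [IsProbabilityMeasure μ] (ν : Measure Y) [IsProbabilityMeasure ν]
    (π₁ : Measure (X × Y)) (h₁ : π₁.map Prod.fst ≤ μ) (h₂ : π₁.map Prod.snd ≤ ν) :
    ∃ π : Measure (X × Y), IsCoupling π μ ν ∧ π₁ ≤ π := by
  set μ₁ := π₁.map Prod.fst with hμ₁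
  set ν₁ := π₁.map Prod.snd with hν₁
  have : IsFiniteMeasure μ₁ := isFiniteMeasure_of_le μ h₁
  have : IsFiniteMeasure ν₁ := isFiniteMeasure_of_le ν h₂
  have hmass : μ₁ Set.univ = ν₁ Set.univ := by
    rw [hμ₁, hν₁, Measure.map_apply measurable_fst .univ, Measure.map_apply measurable_snd .univ]
    simp
  have e₁ : (μ - μ₁) Set.univ = 1 - μ₁ Set.univ := by
    rw [Measure.sub_apply .univ h₁, measure_univ]
  have e₂ : (ν - ν₁) Set.univ = 1 - μ₁ Set.univ := by
    rw [Measure.sub_apply .univ h₂, measure_univ, hmass]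
  set m := 1 - μ₁ Set.univ with hm
  have hmtop : m ≠ ⊤ := ne_top_of_le_ne_top ENNReal.one_ne_top tsub_le_self
  -- Both marginals lack the same mass `m`, so the remainders are coupled independently. For `m = 0`
  -- the remainders vanish and the infinite factor `m⁻¹` is harmless.
  refine ⟨π₁ + m⁻¹ • (μ - μ₁).prod (ν - ν₁), ⟨?_, ?_⟩, Measure.le_add_right le_rfl⟩
  · rw [Measure.map_add _ _ measurable_fst, Measure.map_smul, Measure.map_fst_prod, e₂, smul_smul,
      ← hμ₁]
    rcases eq_or_ne m 0 with h0 | h0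
    · have : μ - μ₁ = 0 := by rw [← Measure.measure_univ_eq_zero, e₁, h0]
      have h := Measure.sub_add_cancel_of_le h₁
      rw [this, zero_add] at h
      rw [this, smul_zero, add_zero, h]
    · rw [ENNReal.inv_mul_cancel h0 hmtop, one_smul, add_comm, Measure.sub_add_cancel_of_le h₁]
  · rw [Measure.map_add _ _ measurable_snd, Measure.map_smul, Measure.map_snd_prod, e₁, smul_smul,
      ← hν₁]
    rcases eq_or_ne m 0 with h0 | h0
    · have : ν - ν₁ = 0 := by rw [← Measure.measure_univ_eq_zero, e₂, h0]
      have h := Measure.sub_add_cancel_of_le h₂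
      rw [this, zero_add] at h
      rw [this, smul_zero, add_zero, h]
    · rw [ENNReal.inv_mul_cancel h0 hmtop, one_smul, add_comm, Measure.sub_add_cancel_of_le h₂]

/-- Let the classes `A y` partition `Y`, and let disjoint events `B y` of a finite space belong to
them. If `μ (B y) ≥ (1 - e y) ν (A y)` then some coupling of `μ` and `ν` is concentrated on
`{(x, y) | x ∈ B y}` up to mass `∫ e`. -/
theorem exists_isCoupling_of_classes {X Y : Type*} [Finite X] [MeasurableSpace X]
    [MeasurableSingletonClass X] [MeasurableSpace Y]
    (μ : Measure X) [IsProbabilityMeasure μ] (ν : Measure Y) [IsProbabilityMeasure ν]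
    (A : Y → Set Y) (B : Y → Set X) (hA : ∀ y, MeasurableSet (A y)) (hpos : ∀ y, ν (A y) ≠ 0)
    (hAA : ∀ y, ∀ y' ∈ A y, A y' = A y ∧ B y' = B y)
    (hB : ∀ x y y', x ∈ B y → x ∈ B y' → y' ∈ A y) (e : Y → ℝ≥0∞)
    (he : ∀ y, ν (A y) ≤ μ (B y) + e y * ν (A y)) :
    ∃ π : Measure (X × Y), IsCoupling π μ ν ∧ ∃ G : Set (X × Y), MeasurableSet G ∧
      (∀ z ∈ G, z.1 ∈ B z.2) ∧ 1 ≤ π G + ∫⁻ y, e y ∂ν := by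
  classical
  have := Fintype.ofFinite X
  let A' : X → Set Y := fun x => {y | x ∈ B y}
  have hA' : ∀ x y, x ∈ B y → A' x = A y := by
    intro x y hxy
    ext y'
    refine ⟨fun h => hB x y y' hxy h, fun h => ?_⟩
    change x ∈ B y'
    rw [(hAA y y' h).2]; exact hxy
  have hA'm : ∀ x, MeasurableSet (A' x) := by
    intro x
    by_cases h : ∃ y, x ∈ B y
    · obtain ⟨y, hy⟩ := h
      rw [hA' x y hy]; exact hA y
    · have : A' x = ∅ := by
        ext y; simp only [A', Set.mem_ofPred_eq, Set.mem_empty_iff_false, iff_false]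
        exact fun hy => h ⟨y, hy⟩
      rw [this]; exact .empty
  let B' : X → Set X := fun x => {x' | ∃ y, x ∈ B y ∧ x' ∈ B y}
  have hB' : ∀ x y, x ∈ B y → B' x = B y := by
    intro x y hxy
    ext x'
    refine ⟨?_, fun h => ⟨y, hxy, h⟩⟩
    rintro ⟨y', h1, h2⟩
    rw [← (hAA y y' (hB x y y' hxy h1)).2]; exact h2
  -- Dividing by the larger of the two masses keeps both marginals of `π₁` below `μ` and `ν`. If `x`
  -- lies in no `B y`, both sets are empty and `c x` may be infinite, but it then multiplies the
  -- zero measure.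
  let c : X → ℝ≥0∞ := fun x => μ {x} * (max (ν (A' x)) (μ (B' x)))⁻¹
  let π₁ : Measure (X × Y) := ∑ x, c x • (Measure.dirac x).prod (ν.restrict (A' x))
  -- The density of the second marginal of `π₁` with respect to `ν`. It is at most 1, and `he` says
  -- that it is at least `1 - e`.
  let h : Y → ℝ≥0∞ := fun y => ∑ x, c x * (A' x).indicator 1 y
  have hh : ∀ y, h y = μ (B y) * (max (ν (A y)) (μ (B y)))⁻¹ := by
    intro y
    have h1 : ∀ x, c x * (A' x).indicator 1 y =
        if x ∈ B y then μ {x} * (max (ν (A y)) (μ (B y)))⁻¹ else 0 := by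
      intro x
      split_ifs with hx
      · rw [Set.indicator_of_mem (show y ∈ A' x from hx)]
        simp only [c, Pi.one_apply, mul_one]
        rw [hA' x y hx, hB' x y hx]
      · rw [Set.indicator_of_notMem (show y ∉ A' x from hx), mul_zero]
    simp only [h, h1]
    rw [← Finset.sum_filter, ← Finset.sum_mul, sum_measure_singleton]
    congr 2
    simp
  have hfst : π₁.map Prod.fst ≤ μ := by
    rw [Measure.le_iff]
    intro s hs
    have h1 : ∀ x, ((c x • (Measure.dirac x).prod (ν.restrict (A' x))).map Prod.fst) s
        = c x * (ν (A' x) * s.indicator 1 x) := by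
      intro x
      rw [Measure.map_smul, Measure.map_fst_prod]
      simp [Measure.dirac_apply' _ hs]
    have h2 : π₁.map Prod.fst s = ∑ x, c x * (ν (A' x) * s.indicator 1 x) := by
      rw [Measure.map_apply measurable_fst hs]
      simp only [π₁, Measure.finsetSum_apply]
      refine Finset.sum_congr rfl fun x _ => ?_
      rw [← h1, Measure.map_apply measurable_fst hs]
    have h3 : μ s = ∑ x, μ {x} * s.indicator 1 x := by
      have : s = ((Finset.univ.filter (· ∈ s) : Finset X) : Set X) := by simp
      conv_lhs => rw [this, ← sum_measure_singleton, Finset.sum_filter]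
      refine Finset.sum_congr rfl fun x _ => ?_
      by_cases hx : x ∈ s <;> simp [hx]
    rw [h2, h3]
    refine Finset.sum_le_sum fun x _ => ?_
    rw [← mul_assoc]
    gcongr
    simp only [c]
    rw [mul_assoc]
    refine (mul_le_mul_right ?_ _).trans (mul_one _).le
    calc _ ≤ (max (ν (A' x)) (μ (B' x)))⁻¹ * max (ν (A' x)) (μ (B' x)) := by
          gcongr; exact le_max_left _ _
      _ ≤ 1 := ENNReal.inv_mul_le_one _
  have hmeas : ∀ x, Measurable fun y => c x * (A' x).indicator 1 y := fun x =>
    (measurable_const.indicator (hA'm x) : Measurable ((A' x).indicator (1 : Y → ℝ≥0∞))).const_mul _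
  have hhm : Measurable h := Finset.measurable_fun_sum _ fun x _ => hmeas x
  have hsnd' : ∀ s, MeasurableSet s → π₁.map Prod.snd s = ∫⁻ y in s, h y ∂ν := by
    intro s hs
    rw [lintegral_finsetSum _ fun x _ => hmeas x, Measure.map_apply measurable_snd hs]
    simp only [π₁, Measure.finsetSum_apply]
    refine Finset.sum_congr rfl fun x _ => ?_
    rw [← Measure.map_apply measurable_snd hs, Measure.map_smul, Measure.map_snd_prod,
      lintegral_const_mul _ (measurable_one.indicator (hA'm x)),
      lintegral_indicator_one (hA'm x), Measure.restrict_apply (hA'm x)]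
    simp [Measure.restrict_apply hs, Set.inter_comm]
  have hsnd : π₁.map Prod.snd ≤ ν := by
    rw [Measure.le_iff]
    intro s hs
    rw [hsnd' s hs]
    calc _ ≤ ∫⁻ y in s, 1 ∂ν := by
          refine lintegral_mono fun y => ?_
          rw [hh]
          calc _ ≤ max (ν (A y)) (μ (B y)) * (max (ν (A y)) (μ (B y)))⁻¹ := by
                gcongr; exact le_max_right _ _
            _ ≤ 1 := ENNReal.mul_inv_le_one _
      _ = ν s := by simp
  obtain ⟨π, hπ, hle⟩ := exists_isCoupling_ge μ ν π₁ hfst hsnd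
  have hG : {z : X × Y | z.1 ∈ B z.2} = ⋃ x, {x} ×ˢ A' x := by
    ext ⟨x, y⟩; simp [A']
  have hGm : MeasurableSet {z : X × Y | z.1 ∈ B z.2} := by
    rw [hG]
    exact MeasurableSet.iUnion fun x => (measurableSet_singleton x).prod (hA'm x)
  refine ⟨π, hπ, _, hGm, fun z hz => hz, ?_⟩
  have hfull : π₁ {z : X × Y | z.1 ∈ B z.2} = ∫⁻ y, h y ∂ν := by
    rw [← setLIntegral_univ, ← hsnd' _ .univ, Measure.map_apply measurable_snd .univ,
      Set.preimage_univ]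
    simp only [π₁, Measure.finsetSum_apply, Measure.smul_apply]
    refine Finset.sum_congr rfl fun x _ => ?_
    congr 1
    rw [Measure.dirac_prod, Measure.map_apply measurable_prodMk_left hGm,
      Measure.map_apply measurable_prodMk_left .univ,
      show Prod.mk x ⁻¹' {z : X × Y | z.1 ∈ B z.2} = A' x from rfl, Set.preimage_univ]
    simp
  calc (1 : ℝ≥0∞) = ∫⁻ _, 1 ∂ν := by simp
    _ ≤ ∫⁻ y, (h y + e y) ∂ν := by
        refine lintegral_mono fun y => ?_
        rw [hh]
        rcases le_total (ν (A y)) (μ (B y)) with hc | hc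
        · rw [max_eq_right hc, ENNReal.mul_inv_cancel _ (measure_ne_top _ _)]
          · exact le_self_add
          · exact fun h0 => hpos y (le_antisymm (hc.trans h0.le) zero_le)
        · rw [max_eq_left hc]
          have := he y
          calc (1 : ℝ≥0∞) = ν (A y) * (ν (A y))⁻¹ :=
                (ENNReal.mul_inv_cancel (hpos y) (measure_ne_top _ _)).symm
            _ ≤ (μ (B y) + e y * ν (A y)) * (ν (A y))⁻¹ := by gcongr
            _ = _ := by
                rw [add_mul, mul_assoc, ENNReal.mul_inv_cancel (hpos y) (measure_ne_top _ _),
                  mul_one]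
    _ = ∫⁻ y, h y ∂ν + ∫⁻ y, e y ∂ν := lintegral_add_left hhm _
    _ ≤ _ := by
        gcongr
        rw [← hfull]; exact hle _

/-! ### Walks and isomorphisms -/

theorem HasWalk.snoc {V : Type*} {H : Hypergraph V} {u v w : V} {k : ℕ} (h : HasWalk H u v k)
    {e : Set V} (he : e ∈ H.edgeSet) (hvw : v ≠ w) (hv : v ∈ e) (hw : w ∈ e) :
    HasWalk H u w (k + 1) := by
  induction h with
  | nil hu => exact .cons he hvw hv hw (.nil (H.subset_vertexSet_of_mem_edgeSet' he hw))
  | cons he' huv hu hv' _ ih => exact .cons he' huv hu hv' (ih hvw hv)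

theorem HasWalk.exists_snoc {V : Type*} {H : Hypergraph V} {u w : V} {k : ℕ}
    (h : HasWalk H u w (k + 1)) :
    ∃ v, ∃ e ∈ H.edgeSet, HasWalk H u v k ∧ v ∈ e ∧ w ∈ e := by
  induction k generalizing u with
  | zero =>
    cases h with
    | cons he huv hu hv hw =>
      cases hw
      exact ⟨u, _, he, .nil (H.subset_vertexSet_of_mem_edgeSet' he hu), hu, hv⟩
  | succ k ih =>
    cases h with
    | cons he huv hu hv hw =>
      obtain ⟨v', e', he', h1, h2, h3⟩ := ih hw
      exact ⟨v', e', he', .cons he huv hu hv h1, h2, h3⟩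

theorem hyperDist_le_iff {V : Type*} (H : Hypergraph V) (u v : V) (t : ℕ) :
    hyperDist H u v ≤ t ↔ ∃ k ≤ t, HasWalk H u v k := by
  constructor
  · intro h
    have hlt : hyperDist H u v < (t + 1 : ℕ) :=
      lt_of_le_of_lt h (by exact_mod_cast Nat.lt_succ_self t)
    obtain ⟨m, ⟨k, hk, rfl⟩, hm⟩ := sInf_lt_iff.1 hlt
    exact ⟨k, Nat.lt_succ_iff.1 (by exact_mod_cast hm), hk⟩
  · rintro ⟨k, hk, hw⟩
    exact (sInf_le ⟨k, hw, rfl⟩ : hyperDist H u v ≤ k).trans (by exact_mod_cast hk)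

/-- Embeddings run from addresses to labels, so the isomorphism is the inverse of the restriction of
`f`. -/
theorem SpinIso.of_bijOn {V V' : Type*} {X : RootedSpinHypergraph V}
    {Y : RootedSpinHypergraph V'} (f : V' → V)
    (hf : Set.BijOn f Y.graph.vertexSet X.graph.vertexSet) (hroot : f Y.root = X.root)
    (hedge : ∀ S ⊆ Y.graph.vertexSet, f '' S ∈ X.graph.edgeSet ↔ S ∈ Y.graph.edgeSet)
    (hspin : ∀ v ∈ Y.graph.vertexSet, X.spin (f v) = Y.spin v) : SpinIso X Y := by
  let g : Y.graph.vertexSet ≃ X.graph.vertexSet := hf.equiv f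
  have hg : ∀ v, ((g v : X.graph.vertexSet) : V) = f v := fun v => rfl
  have hgs : ∀ v, f (g.symm v) = v := fun v => by rw [← hg, Equiv.apply_symm_apply]
  refine ⟨g.symm, ?_, fun e => ?_, fun v => ?_⟩
  · rw [Equiv.symm_apply_eq]
    exact Subtype.ext hroot.symm
  · rw [← hedge _ (by rintro _ ⟨w, _, rfl⟩; exact w.2)]
    congr! 1
    rw [← Set.image_comp, ← Set.image_comp]
    exact Set.image_congr fun v _ => (hgs v).symm
  · rw [← hspin _ (g.symm v).2, hgs]

namespace HSBMParams

/-! ### The truncated hypertree -/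

/-- The vertices of the hypertree at depth at most `l`. -/
def nodes (P : HSBMParams) (l : ℕ) (ω : P.Growth) : Set P.Address :=
  {v | P.present ω v ∧ v.length ≤ l}

/-- The vertices of the hypertree at depth less than `l`. -/
def internal (P : HSBMParams) (l : ℕ) (ω : P.Growth) : Set P.Address :=
  {v | P.present ω v ∧ v.length < l}

/-- The `k`-th hyperedge generated by `v`. -/
def treeEdge (P : HSBMParams) (v : P.Address) (k : ℕ) : Set P.Address :=
  insert v (Set.range fun j : Fin (P.d - 1) => ((k, j) :: v : P.Address))

theorem mem_treeEdge {P : HSBMParams} {v w : P.Address} {k : ℕ} :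
    w ∈ P.treeEdge v k ↔ w = v ∨ ∃ j, w = (k, j) :: v := by
  simp [treeEdge, eq_comm]

theorem internal_subset_nodes (P : HSBMParams) (l : ℕ) (ω : P.Growth) :
    P.internal l ω ⊆ P.nodes l ω := fun _ h => ⟨h.1, h.2.le⟩

theorem nil_mem_nodes (P : HSBMParams) (l : ℕ) (ω : P.Growth) : [] ∈ P.nodes l ω :=
  ⟨trivial, Nat.zero_le _⟩

theorem cons_mem_nodes {P : HSBMParams} {l : ℕ} {ω : P.Growth} {k : ℕ} {j : Fin (P.d - 1)}
    {v : P.Address} :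
    (k, j) :: v ∈ P.nodes l ω ↔ v ∈ P.internal l ω ∧ k < (ω v).1 := by
  simp only [nodes, internal, Set.mem_ofPred_eq, present, List.length_cons, Nat.succ_le_iff]
  tauto

theorem treeEdge_subset_nodes {P : HSBMParams} {l : ℕ} {ω : P.Growth} {k : ℕ}
    {v : P.Address} (hv : v ∈ P.internal l ω) (hk : k < (ω v).1) :
    P.treeEdge v k ⊆ P.nodes l ω := by
  intro w hw
  rcases mem_treeEdge.1 hw with rfl | ⟨j, rfl⟩
  · exact P.internal_subset_nodes l ω hv
  · exact cons_mem_nodes.2 ⟨hv, hk⟩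

theorem one_le_d_sub_one (P : HSBMParams) : 0 < P.d - 1 := by have := P.three_le_d; omega

theorem treeEdge_subset_nodes_iff {P : HSBMParams} {l : ℕ} {ω : P.Growth} {k : ℕ}
    {v : P.Address} :
    P.treeEdge v k ⊆ P.nodes l ω ↔ v ∈ P.internal l ω ∧ k < (ω v).1 :=
  ⟨fun h => cons_mem_nodes.1 (h (mem_treeEdge.2 (Or.inr ⟨⟨0, P.one_le_d_sub_one⟩, rfl⟩))),
    fun h => treeEdge_subset_nodes h.1 h.2⟩

/-- The generating vertex is the only address of minimal length in its hyperedge, and any child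
records the index `k`. -/
theorem treeEdge_injective {P : HSBMParams} {v v' : P.Address} {k k' : ℕ}
    (h : P.treeEdge v k = P.treeEdge v' k') : v = v' ∧ k = k' := by
  have key : ∀ {v v' : P.Address} {k k' : ℕ}, P.treeEdge v k = P.treeEdge v' k' →
      v'.length ≤ v.length := by
    intro v v' k k' h
    have : v ∈ P.treeEdge v' k' := h ▸ mem_treeEdge.2 (Or.inl rfl)
    rcases mem_treeEdge.1 this with rfl | ⟨j, rfl⟩ <;> simp
  have hl : v.length = v'.length := le_antisymm (key h.symm) (key h)
  have hvv : v = v' := by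
    have : v ∈ P.treeEdge v' k' := h ▸ mem_treeEdge.2 (Or.inl rfl)
    rcases mem_treeEdge.1 this with rfl | ⟨j, rfl⟩
    · rfl
    · simp at hl
  subst hvv
  refine ⟨rfl, ?_⟩
  have : (k, (⟨0, P.one_le_d_sub_one⟩ : Fin (P.d - 1))) :: v ∈ P.treeEdge v k' :=
    h ▸ mem_treeEdge.2 (Or.inr ⟨_, rfl⟩)
  rcases mem_treeEdge.1 this with h | ⟨j, h⟩
  · exact absurd (congrArg List.length h) (by simp)
  · simp at h; exact h.1

theorem hasWalk_tree {P : HSBMParams} (s : ℤˣ) (ω : P.Growth) (v : P.Address)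
    (hv : P.present ω v) : HasWalk (P.treeGraph s ω).graph [] v v.length := by
  induction v with
  | nil => exact .nil trivial
  | cons p v ih =>
    obtain ⟨k, j⟩ := p
    exact (ih hv.1).snoc (e := P.treeEdge v k) ⟨v, k, hv.1, hv.2, rfl⟩
      (fun h => absurd (congrArg List.length h) (by simp)) (mem_treeEdge.2 (Or.inl rfl))
      (mem_treeEdge.2 (Or.inr ⟨j, rfl⟩))

/-- Address lengths within one hyperedge differ by at most one. Together with `hasWalk_tree` this
identifies the distance from the root with the length of the address. -/
theorem length_le_of_hasWalk_tree {P : HSBMParams} (s : ℤˣ) (ω : P.Growth) {u w : P.Address}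
    {k : ℕ} (h : HasWalk (P.treeGraph s ω).graph u w k) : w.length ≤ u.length + k := by
  induction h with
  | nil => simp
  | cons he huv hu hv _ ih =>
    obtain ⟨v, k, _, _, rfl⟩ := he
    have h1 := mem_treeEdge.1 hu
    have h2 := mem_treeEdge.1 hv
    rcases h1 with rfl | ⟨j, rfl⟩ <;> rcases h2 with rfl | ⟨j', rfl⟩ <;>
      (try simp only [List.length_cons] at *) <;> omega

theorem truncate_tree_vertexSet (P : HSBMParams) (s : ℤˣ) (ω : P.Growth) (l : ℕ) :
    ((P.treeGraph s ω).truncate l).graph.vertexSet = P.nodes l ω := by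
  ext v
  change (P.present ω v ∧ hyperDist _ [] v ≤ l) ↔ _
  rw [hyperDist_le_iff]
  refine and_congr_right fun hv => ⟨?_, fun h => ⟨_, h, hasWalk_tree s ω v hv⟩⟩
  rintro ⟨k, hk, hw⟩
  have := length_le_of_hasWalk_tree s ω hw
  simp at this
  omega

/-- `φ` embeds the hypertree truncated at depth `l` in the spin hypergraph `x`, with the root at
`i`, such that it is the neighbourhood of `i` of radius `l`. -/
structure Embeds (P : HSBMParams) {n : ℕ} (l : ℕ) (s : ℤˣ) (i : Fin n) (ω : P.Growth)
    (φ : P.Address → Fin n) (x : P.Sample n) : Prop where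
  root : φ [] = i
  inj : Set.InjOn φ (P.nodes l ω)
  spin : ∀ v ∈ P.nodes l ω, x.2 (φ v) = P.treeSpin s ω v
  edge : ∀ v ∈ P.internal l ω, ∀ k < (ω v).1,
    φ '' P.treeEdge v k ∈ (P.sampleGraph x i).graph.edgeSet
  of_edge : ∀ e ∈ (P.sampleGraph x i).graph.edgeSet,
    ((∃ v ∈ P.internal l ω, φ v ∈ e) ∨ e ⊆ φ '' P.nodes l ω) →
      ∃ v ∈ P.internal l ω, ∃ k < (ω v).1, e = φ '' P.treeEdge v k

namespace Embeds

variable {P : HSBMParams} {n l : ℕ} {s : ℤˣ} {i : Fin n} {ω : P.Growth}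
  {φ : P.Address → Fin n} {x : P.Sample n}

theorem hasWalk (h : P.Embeds l s i ω φ x) (v : P.Address) (hv : v ∈ P.nodes l ω) :
    HasWalk (P.sampleGraph x i).graph i (φ v) v.length := by
  induction v with
  | nil => rw [h.root]; exact .nil trivial
  | cons p v ih =>
    obtain ⟨k, j⟩ := p
    have hv' := cons_mem_nodes.1 hv
    have hv'' := P.internal_subset_nodes l ω hv'.1
    refine (ih hv'').snoc (h.edge v hv'.1 k hv'.2) ?_
      ⟨v, mem_treeEdge.2 (Or.inl rfl), rfl⟩ ⟨_, mem_treeEdge.2 (Or.inr ⟨j, rfl⟩), rfl⟩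
    exact fun he => absurd (congrArg List.length (h.inj hv'' hv he)) (by simp)

/-- The penultimate vertex of the walk is the image of a vertex of depth less than `l`. By `of_edge`
the last hyperedge is then the image of a tree hyperedge, which increases the depth by at most one.
-/
theorem exists_of_hasWalk (h : P.Embeds l s i ω φ x) {k : ℕ} (hk : k ≤ l) {y : Fin n}
    (hw : HasWalk (P.sampleGraph x i).graph i y k) :
    ∃ v ∈ P.nodes l ω, v.length ≤ k ∧ φ v = y := by
  induction k generalizing y with
  | zero =>
    cases hw
    exact ⟨[], P.nil_mem_nodes l ω, le_rfl, h.root⟩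
  | succ k ih =>
    obtain ⟨y', e, he, hw', hy', hy⟩ := hw.exists_snoc
    obtain ⟨v, hv, hvk, rfl⟩ := ih (by omega) hw'
    have hvi : v ∈ P.internal l ω := ⟨hv.1, by omega⟩
    obtain ⟨v', hv', k', hk', rfl⟩ := h.of_edge e he (Or.inl ⟨v, hvi, hy'⟩)
    obtain ⟨w', hw1, hw2⟩ := hy'
    have hsub := treeEdge_subset_nodes hv' hk'
    have : w' = v := h.inj (hsub hw1) hv hw2
    subst this
    obtain ⟨w, hw3, rfl⟩ := hy
    refine ⟨w, hsub hw3, ?_, rfl⟩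
    rcases mem_treeEdge.1 hw1 with rfl | ⟨j, rfl⟩ <;>
      rcases mem_treeEdge.1 hw3 with rfl | ⟨j', rfl⟩ <;>
      simp only [List.length_cons] at * <;> omega

theorem spinIso (h : P.Embeds l s i ω φ x) :
    SpinIso ((P.sampleGraph x i).truncate l) ((P.treeGraph s ω).truncate l) := by
  have hX : ((P.sampleGraph x i).truncate l).graph.vertexSet = φ '' P.nodes l ω := by
    ext y
    change (y ∈ Set.univ ∧ hyperDist _ i y ≤ l) ↔ _
    rw [hyperDist_le_iff]
    constructor
    · rintro ⟨-, k, hk, hw⟩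
      obtain ⟨v, hv, -, rfl⟩ := h.exists_of_hasWalk hk hw
      exact ⟨v, hv, rfl⟩
    · rintro ⟨v, hv, rfl⟩
      exact ⟨trivial, v.length, hv.2, h.hasWalk v hv⟩
  refine SpinIso.of_bijOn φ ?_ h.root (fun S hS => ?_) fun v hv => ?_
  · rw [hX, truncate_tree_vertexSet]
    exact h.inj.bijOn_image
  · rw [truncate_tree_vertexSet] at hS
    have e1 : φ '' S ∈ ((P.sampleGraph x i).truncate l).graph.edgeSet ↔
        φ '' S ∈ (P.sampleGraph x i).graph.edgeSet := by
      refine ⟨fun h => h.1, fun h' => ⟨h', fun y hy => ?_⟩⟩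
      have : y ∈ ((P.sampleGraph x i).truncate l).graph.vertexSet := by
        rw [hX]; exact Set.image_mono hS hy
      exact this
    have e2 : S ∈ ((P.treeGraph s ω).truncate l).graph.edgeSet ↔
        S ∈ (P.treeGraph s ω).graph.edgeSet := by
      refine ⟨fun h => h.1, fun h' => ⟨h', fun v hv => ?_⟩⟩
      have : v ∈ ((P.treeGraph s ω).truncate l).graph.vertexSet := by
        rw [truncate_tree_vertexSet]; exact hS hv
      exact this
    rw [e1, e2]
    constructor
    · intro he
      -- The second alternative in `of_edge` matters here: the induced truncation would also contain
      -- hyperedges joining only vertices of depth `l`.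
      obtain ⟨v, hv, k, hk, heq⟩ := h.of_edge _ he (Or.inr (Set.image_mono hS))
      have : S = P.treeEdge v k :=
        (h.inj.image_eq_image_iff hS (treeEdge_subset_nodes hv hk)).1 heq
      exact ⟨v, k, hv.1, hk, this⟩
    · rintro ⟨v, k, hv, hk, rfl⟩
      exact h.edge v (treeEdge_subset_nodes_iff.1 hS).1 k hk
  · rw [truncate_tree_vertexSet] at hv
    exact h.spin v hv

end Embeds

end HSBMParams

/-! ### Classes of growths and uniqueness of sorted embeddings -/

/-- Two families enumerated increasingly with respect to a key, with the same values, agree. -/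
theorem eq_of_strictMono_key {β γ : Type*} [LinearOrder γ] (key : β → γ) {a b : ℕ} {f g : ℕ → β}
    (hf : ∀ k k', k < k' → k' < a → key (f k) < key (f k'))
    (hg : ∀ k k', k < k' → k' < b → key (g k) < key (g k'))
    (hfg : ∀ k < a, ∃ k' < b, f k = g k') (hgf : ∀ k < b, ∃ k' < a, g k = f k') :
    a = b ∧ ∀ k < a, f k = g k := by
  have hF : StrictMono fun k : Fin a => key (f k) := fun k k' h => hf k k' h k'.2
  have hG : StrictMono fun k : Fin b => key (g k) := fun k k' h => hg k k' h k'.2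
  have hr : Set.range (fun k : Fin a => key (f k)) = Set.range fun k : Fin b => key (g k) := by
    ext y
    constructor
    · rintro ⟨k, rfl⟩
      obtain ⟨k', hk', h⟩ := hfg k k.2
      exact ⟨⟨k', hk'⟩, by simp [h]⟩
    · rintro ⟨k, rfl⟩
      obtain ⟨k', hk', h⟩ := hgf k k.2
      exact ⟨⟨k', hk'⟩, by simp [h]⟩
  have hab : a = b := by
    have h1 := Set.ncard_range_of_injective hF.injective
    have h2 := Set.ncard_range_of_injective hG.injective
    rw [hr, h2] at h1
    simpa using h1.symm
  subst hab
  have hFG := (hF.range_inj hG).1 hr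
  refine ⟨rfl, fun k hk => ?_⟩
  obtain ⟨k', hk', h⟩ := hfg k hk
  have h1 : key (f k) = key (g k) := congrFun hFG ⟨k, hk⟩
  have h2 : (⟨k, hk⟩ : Fin a) = ⟨k', hk'⟩ := hG.injective (by simp only; rw [← h1, h])
  rw [h]
  simp at h2
  rw [h2]

namespace HSBMParams

/-- The growths which agree with `ω` up to depth `l`. -/
def growthClass (P : HSBMParams) (l : ℕ) (ω : P.Growth) : Set P.Growth :=
  {ω' | ∀ v ∈ P.internal l ω, (ω' v).1 = (ω v).1 ∧ ∀ k < (ω v).1, (ω' v).2 k = (ω v).2 k}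

section growthClass

variable {P : HSBMParams} {l : ℕ} {ω ω' : P.Growth}

/-- Presence of a vertex depends only on the growth at its proper ancestors, which are interior. -/
theorem nodes_eq_of_mem_growthClass (h : ω' ∈ P.growthClass l ω) :
    P.nodes l ω' = P.nodes l ω := by
  have key : ∀ v : P.Address, v.length ≤ l → (P.present ω' v ↔ P.present ω v) := by
    intro v
    induction v with
    | nil => intro _; exact Iff.rfl
    | cons p v ih =>
      obtain ⟨k, j⟩ := p
      intro hl
      simp only [List.length_cons] at hl
      have ih' := ih (by omega)
      simp only [present]
      rw [ih']
      refine and_congr_right fun hv => ?_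
      rw [(h v ⟨hv, by omega⟩).1]
  ext v
  exact and_congr_left fun hl => key v hl

theorem internal_eq_of_mem_growthClass (h : ω' ∈ P.growthClass l ω) :
    P.internal l ω' = P.internal l ω := by
  have := nodes_eq_of_mem_growthClass h
  ext v
  refine and_congr_left fun hl => ?_
  have h1 := Set.ext_iff.1 this v
  simp only [nodes, Set.mem_ofPred_eq] at h1
  have hl' := hl.le
  tauto

theorem treeSpin_eq_of_mem_growthClass (h : ω' ∈ P.growthClass l ω) (s : ℤˣ) (v : P.Address)
    (hv : v ∈ P.nodes l ω) : P.treeSpin s ω' v = P.treeSpin s ω v := by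
  induction v with
  | nil => rfl
  | cons p v ih =>
    obtain ⟨k, j⟩ := p
    have hv' := cons_mem_nodes.1 hv
    have ih' := ih (P.internal_subset_nodes l ω hv'.1)
    simp only [treeSpin]
    rw [ih', (h v hv'.1).2 k hv'.2]

theorem mem_growthClass_symm (h : ω' ∈ P.growthClass l ω) : ω ∈ P.growthClass l ω' := by
  intro v hv
  rw [internal_eq_of_mem_growthClass h] at hv
  obtain ⟨h1, h2⟩ := h v hv
  exact ⟨h1.symm, fun k hk => (h2 k (h1 ▸ hk)).symm⟩

theorem growthClass_subset (h : ω' ∈ P.growthClass l ω) :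
    P.growthClass l ω' ⊆ P.growthClass l ω := by
  intro ω'' h' v hv
  obtain ⟨h1, h2⟩ := h v hv
  rw [← internal_eq_of_mem_growthClass h] at hv
  obtain ⟨h3, h4⟩ := h' v hv
  exact ⟨h3.trans h1, fun k hk => (h4 k (h1 ▸ hk)).trans (h2 k hk)⟩

theorem growthClass_eq (h : ω' ∈ P.growthClass l ω) : P.growthClass l ω' = P.growthClass l ω :=
  (growthClass_subset h).antisymm (growthClass_subset (mem_growthClass_symm h))

theorem Embeds.of_mem_growthClass {n : ℕ} {s : ℤˣ} {i : Fin n} {φ : P.Address → Fin n}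
    {x : P.Sample n} (h : ω' ∈ P.growthClass l ω) (he : P.Embeds l s i ω φ x) :
    P.Embeds l s i ω' φ x := by
  have hn := nodes_eq_of_mem_growthClass h
  have hi := internal_eq_of_mem_growthClass h
  refine ⟨he.root, hn ▸ he.inj, fun v hv => ?_, fun v hv k hk => ?_, fun e hee hc => ?_⟩
  · rw [hn] at hv
    rw [he.spin v hv, treeSpin_eq_of_mem_growthClass h s v hv]
  · rw [hi] at hv
    exact he.edge v hv k ((h v hv).1 ▸ hk)
  · rw [hi, hn] at hc
    obtain ⟨v, hv, k, hk, heq⟩ := he.of_edge e hee hc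
    exact ⟨v, hi ▸ hv, k, (h v hv).1 ▸ hk, heq⟩

end growthClass

/-- The labels `φ` are increasing along the children in each hyperedge, and the hyperedges
generated by a vertex are ordered by the labels of their first children. -/
def SortedLabels (P : HSBMParams) {n : ℕ} (l : ℕ) (ω : P.Growth) (φ : P.Address → Fin n) : Prop :=
  ∀ v ∈ P.internal l ω, (∀ k < (ω v).1, StrictMono fun j => φ ((k, j) :: v)) ∧
    ∀ k k', k < k' → k' < (ω v).1 →
      φ ((k, ⟨0, P.one_le_d_sub_one⟩) :: v) < φ ((k', ⟨0, P.one_le_d_sub_one⟩) :: v)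

theorem SortedLabels.of_mem_growthClass {P : HSBMParams} {l : ℕ} {ω ω' : P.Growth} {n : ℕ}
    {φ : P.Address → Fin n} (h : ω' ∈ P.growthClass l ω) (hs : P.SortedLabels l ω φ) :
    P.SortedLabels l ω' φ := by
  intro v hv
  rw [internal_eq_of_mem_growthClass h] at hv
  rw [(h v hv).1]
  exact hs v hv

namespace Embeds

variable {P : HSBMParams} {n l : ℕ} {s : ℤˣ} {i : Fin n} {ω ω' : P.Growth}
  {φ φ' : P.Address → Fin n} {x : P.Sample n}

/-- The image of the `k`-th hyperedge of `v` contains `φ' v`, so it is also the `φ'`-image of a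
hyperedge of the second tree. Once the parent there is shown to be `v`, the two rows of children
have the same range, and increasing rows with equal range coincide. -/
theorem exists_row_eq (h : P.Embeds l s i ω φ x) (h' : P.Embeds l s i ω' φ' x)
    (hs : P.SortedLabels l ω φ) (hs' : P.SortedLabels l ω' φ') {v : P.Address}
    (hv : v ∈ P.internal l ω) (hv' : v ∈ P.internal l ω')
    (ih : ∀ w : P.Address, w.length ≤ v.length →
      (w ∈ P.nodes l ω ↔ w ∈ P.nodes l ω') ∧ (w ∈ P.nodes l ω → φ w = φ' w))
    {k : ℕ} (hk : k < (ω v).1) :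
    ∃ k' < (ω' v).1, (fun j => φ ((k, j) :: v)) = fun j => φ' ((k', j) :: v) := by
  have hφv : φ v = φ' v := (ih v le_rfl).2 (P.internal_subset_nodes l ω hv)
  have hmem : φ' v ∈ φ '' P.treeEdge v k := ⟨v, mem_treeEdge.2 (Or.inl rfl), hφv⟩
  obtain ⟨v₂, hv₂, k₂, hk₂, heq⟩ := h'.of_edge _ (h.edge v hv k hk) (Or.inl ⟨v, hv', hmem⟩)
  have hsub := treeEdge_subset_nodes hv hk
  have hsub₂ := treeEdge_subset_nodes hv₂ hk₂
  have hv2 : v ∈ P.treeEdge v₂ k₂ := by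
    rw [heq] at hmem
    obtain ⟨w, hw, hww⟩ := hmem
    rwa [← h'.inj (hsub₂ hw) (P.internal_subset_nodes l ω' hv') hww]
  -- If `v` were a child in that hyperedge, all its vertices would have length at most `v.length`,
  -- where `φ` and `φ'` agree. Injectivity of `φ` then makes it the hyperedge generated by `v`.
  have hvv : v = v₂ := by
    rcases mem_treeEdge.1 hv2 with h1 | ⟨j, hj⟩
    · exact h1
    · have hlen : ∀ w ∈ P.treeEdge v₂ k₂, w.length ≤ v.length := by
        intro w hw
        rw [hj]
        rcases mem_treeEdge.1 hw with rfl | ⟨j', rfl⟩ <;> simp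
      have hmemω : P.treeEdge v₂ k₂ ⊆ P.nodes l ω := fun w hw =>
        (ih w (hlen w hw)).1.2 (hsub₂ hw)
      have : φ' '' P.treeEdge v₂ k₂ = φ '' P.treeEdge v₂ k₂ :=
        Set.image_congr fun w hw => ((ih w (hlen w hw)).2 (hmemω hw)).symm
      rw [this] at heq
      exact (treeEdge_injective ((h.inj.image_eq_image_iff hsub hmemω).1 heq)).1
  subst hvv
  refine ⟨k₂, hk₂, ?_⟩
  rw [← ((hs v hv).1 k hk).range_inj ((hs' v hv').1 k₂ hk₂)]
  have key : ∀ {ω : P.Growth} {φ : P.Address → Fin n} {k : ℕ}, P.Embeds l s i ω φ x →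
      P.treeEdge v k ⊆ P.nodes l ω →
      Set.range (fun j => φ ((k, j) :: v)) = φ '' P.treeEdge v k \ {φ v} := by
    intro ω φ k h hsub
    have hnot : φ v ∉ Set.range fun j => φ ((k, j) :: v) := by
      rintro ⟨j, hj⟩
      have := h.inj (hsub (mem_treeEdge.2 (Or.inr ⟨j, rfl⟩))) (hsub (mem_treeEdge.2 (Or.inl rfl))) hj
      exact absurd (congrArg List.length this) (by simp)
    rw [treeEdge, Set.image_insert_eq, ← Set.range_comp]
    exact (Set.insert_sdiff_self_of_notMem hnot).symm
  rw [key h hsub, key h' hsub₂, heq, hφv]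

/-- The rows of the two embeddings form the same set, and both enumerations are sorted by the label
of the first child. -/
theorem rows_eq (h : P.Embeds l s i ω φ x) (h' : P.Embeds l s i ω' φ' x)
    (hs : P.SortedLabels l ω φ) (hs' : P.SortedLabels l ω' φ') {v : P.Address}
    (hv : v ∈ P.internal l ω) (hv' : v ∈ P.internal l ω')
    (ih : ∀ w : P.Address, w.length ≤ v.length →
      (w ∈ P.nodes l ω ↔ w ∈ P.nodes l ω') ∧ (w ∈ P.nodes l ω → φ w = φ' w)) :
    (ω v).1 = (ω' v).1 ∧ ∀ k < (ω v).1, ∀ j, φ ((k, j) :: v) = φ' ((k, j) :: v) := by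
  have ih' : ∀ w : P.Address, w.length ≤ v.length →
      (w ∈ P.nodes l ω' ↔ w ∈ P.nodes l ω) ∧ (w ∈ P.nodes l ω' → φ' w = φ w) := fun w hw =>
    ⟨(ih w hw).1.symm, fun hw' => ((ih w hw).2 ((ih w hw).1.2 hw')).symm⟩
  have := eq_of_strictMono_key (fun R : Fin (P.d - 1) → Fin n => R ⟨0, P.one_le_d_sub_one⟩)
    (hs v hv).2 (hs' v hv').2
    (fun k hk => h.exists_row_eq h' hs hs' hv hv' ih hk)
    (fun k hk => h'.exists_row_eq h hs' hs hv' hv ih' hk)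
  exact ⟨this.1, fun k hk j => congrFun (this.2 k hk) j⟩

theorem eq_up_to_depth (h : P.Embeds l s i ω φ x) (h' : P.Embeds l s i ω' φ' x)
    (hs : P.SortedLabels l ω φ) (hs' : P.SortedLabels l ω' φ') (m : ℕ) :
    ∀ w : P.Address, w.length ≤ m →
      (w ∈ P.nodes l ω ↔ w ∈ P.nodes l ω') ∧ (w ∈ P.nodes l ω → φ w = φ' w) := by
  induction m with
  | zero =>
    intro w hw
    obtain rfl : w = [] := List.length_eq_zero_iff.1 (Nat.le_zero.1 hw)
    simp [nil_mem_nodes, h.root, h'.root]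
  | succ m ih =>
    intro w hw
    rcases w with _ | ⟨⟨k, j⟩, v⟩
    · exact ih _ (Nat.zero_le _)
    simp only [List.length_cons, Nat.succ_le_succ_iff] at hw
    have hint : v ∈ P.internal l ω ↔ v ∈ P.internal l ω' := by
      refine and_congr_left fun hl => ?_
      have := (ih v hw).1
      simp only [nodes, Set.mem_ofPred_eq] at this
      have hl' := hl.le
      tauto
    have key := fun (hv : v ∈ P.internal l ω) =>
      h.rows_eq h' hs hs' hv (hint.1 hv) fun w hw' => ih w (hw'.trans hw)
    rw [cons_mem_nodes, cons_mem_nodes, ← hint]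
    refine ⟨and_congr_right fun hv => by rw [(key hv).1], fun hv => (key hv.1).2 k hv.2 j⟩

/-- A spin hypergraph determines the truncated hypertree with increasing labels embedded in it. -/
theorem unique (h : P.Embeds l s i ω φ x) (h' : P.Embeds l s i ω' φ' x)
    (hs : P.SortedLabels l ω φ) (hs' : P.SortedLabels l ω' φ') :
    ω' ∈ P.growthClass l ω ∧ Set.EqOn φ φ' (P.nodes l ω) := by
  have key := h.eq_up_to_depth h' hs hs' l
  refine ⟨fun v hv => ?_, fun w hw => (key w hw.2).2 hw⟩
  have hv' : v ∈ P.internal l ω' :=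
    ⟨((key v hv.2.le).1.1 (P.internal_subset_nodes l ω hv)).1, hv.2⟩
  have hrow := h.rows_eq h' hs hs' hv hv' fun w hw => key w (hw.trans hv.2.le)
  refine ⟨hrow.1.symm, fun k hk => ?_⟩
  -- The sets of agreeing children are recovered by comparing the spin of each child with that of
  -- its parent, since no spin equals its negative.
  ext j
  have hvn := P.internal_subset_nodes l ω hv
  have hwn : (k, j) :: v ∈ P.nodes l ω := cons_mem_nodes.2 ⟨hv, hk⟩
  have hwn' : (k, j) :: v ∈ P.nodes l ω' := cons_mem_nodes.2 ⟨hv', hrow.1 ▸ hk⟩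
  have s1 := h.spin _ hvn
  have s2 := h'.spin _ (P.internal_subset_nodes l ω' hv')
  have s3 := h.spin _ hwn
  have s4 := h'.spin _ hwn'
  rw [(key v hv.2.le).2 hvn] at s1
  rw [hrow.2 k hk j, s4] at s3
  simp only [treeSpin] at s3
  rw [← s1, ← s2] at s3
  have hne : -x.2 (φ' v) ≠ x.2 (φ' v) := by
    intro h0
    rcases Int.units_eq_one_or (x.2 (φ' v)) with h1 | h1 <;> rw [h1] at h0 <;>
      exact absurd h0 (by decide)
  by_cases h1 : j ∈ (ω v).2 k <;> by_cases h2 : j ∈ (ω' v).2 k <;> simp_all [eq_comm]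

end Embeds

end HSBMParams

namespace HSBMParams

/-! ### Finiteness of the truncated hypertree -/

theorem finite_nodes (P : HSBMParams) (l : ℕ) (ω : P.Growth) : (P.nodes l ω).Finite := by
  induction l with
  | zero =>
    refine (Set.finite_singleton ([] : P.Address)).subset fun v hv => ?_
    exact List.length_eq_zero_iff.1 (Nat.le_zero.1 hv.2)
  | succ l ih =>
    have hfin : (⋃ v ∈ P.nodes l ω, ⋃ k ∈ Set.Iio (ω v).1,
        Set.range fun j : Fin (P.d - 1) => ((k, j) :: v : P.Address)).Finite :=
      ih.biUnion fun v _ => (Set.finite_Iio _).biUnion fun k _ => Set.finite_range _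
    refine (hfin.insert []).subset fun v hv => ?_
    rcases v with _ | ⟨⟨k, j⟩, v⟩
    · exact Or.inl rfl
    · right
      have hv' := cons_mem_nodes.1 hv
      simp only [Set.mem_iUnion]
      exact ⟨v, ⟨hv'.1.1, Nat.lt_succ_iff.1 hv'.1.2⟩, k, hv'.2, j, rfl⟩

/-- The vertices of the truncated hypertree as a finite set. -/
noncomputable def nodeFin (P : HSBMParams) (l : ℕ) (ω : P.Growth) : Finset P.Address :=
  (P.finite_nodes l ω).toFinset

/-- The vertices of the truncated hypertree at depth less than `l` as a finite set. -/
noncomputable def internalFin (P : HSBMParams) (l : ℕ) (ω : P.Growth) : Finset P.Address :=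
  ((P.finite_nodes l ω).subset (P.internal_subset_nodes l ω)).toFinset

/-- The hyperedges of the truncated hypertree: the pair `(v, k)` stands for the `k`-th hyperedge
generated by `v`. -/
noncomputable def edgeFin (P : HSBMParams) (l : ℕ) (ω : P.Growth) :
    Finset ((_ : P.Address) × ℕ) :=
  (P.internalFin l ω).sigma fun v => Finset.range (ω v).1

variable {P : HSBMParams} {l : ℕ} {ω : P.Growth}

@[simp] theorem mem_nodeFin {v : P.Address} : v ∈ P.nodeFin l ω ↔ v ∈ P.nodes l ω := by
  simp [nodeFin]

@[simp] theorem mem_internalFin {v : P.Address} :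
    v ∈ P.internalFin l ω ↔ v ∈ P.internal l ω := by
  simp [internalFin]

@[simp] theorem coe_internalFin : (P.internalFin l ω : Set P.Address) = P.internal l ω := by
  simp [internalFin]

theorem mem_edgeFin {t : (_ : P.Address) × ℕ} :
    t ∈ P.edgeFin l ω ↔ t.1 ∈ P.internal l ω ∧ t.2 < (ω t.1).1 := by
  simp [edgeFin]

theorem internalFin_subset_nodeFin (P : HSBMParams) (l : ℕ) (ω : P.Growth) :
    P.internalFin l ω ⊆ P.nodeFin l ω := fun v hv => by
  rw [mem_nodeFin]; exact P.internal_subset_nodes l ω (mem_internalFin.1 hv)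

/-- Each vertex other than the root is a child in exactly one hyperedge. -/
theorem card_nodeFin (P : HSBMParams) (l : ℕ) (ω : P.Growth) :
    (P.nodeFin l ω).card = 1 + (P.d - 1) * (P.edgeFin l ω).card := by
  classical
  let f : ((_ : P.Address) × ℕ) × Fin (P.d - 1) → P.Address := fun t => (t.1.2, t.2) :: t.1.1
  have hf : Function.Injective f := by
    rintro ⟨⟨v, k⟩, j⟩ ⟨⟨v', k'⟩, j'⟩ h
    simp only [f, List.cons.injEq, Prod.mk.injEq] at h
    obtain ⟨⟨rfl, rfl⟩, rfl⟩ := h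
    rfl
  have h : P.nodeFin l ω = insert [] ((P.edgeFin l ω ×ˢ Finset.univ).image f) := by
    ext v
    rcases v with _ | ⟨⟨k, j⟩, v⟩
    · simp [nil_mem_nodes]
    · simp only [mem_nodeFin, cons_mem_nodes, Finset.mem_insert, List.cons_ne_nil, false_or,
        Finset.mem_image, Finset.mem_product, mem_edgeFin, f, Finset.mem_univ, and_true]
      constructor
      · intro h; exact ⟨⟨⟨v, k⟩, j⟩, h, rfl⟩
      · rintro ⟨⟨⟨v', k'⟩, j'⟩, h, he⟩
        simp only [List.cons.injEq, Prod.mk.injEq] at he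
        obtain ⟨⟨rfl, rfl⟩, rfl⟩ := he
        exact h
  rw [h, Finset.card_insert_of_notMem (by simp [f]), Finset.card_image_of_injective _ hf,
    Finset.card_product, Finset.card_univ, Fintype.card_fin]
  ring

/-! ### The probability of a class of growths -/

/-- The mean number of hyperedges generated by a vertex. -/
noncomputable def edgeMean (P : HSBMParams) : ℝ := P.alpha / ((P.d : ℝ) - 1)

/-- The constant `a` or `b` which governs the hyperedges whose set of agreeing children is `R`. -/
noncomputable def edgeWeight (P : HSBMParams) (R : Finset (Fin (P.d - 1))) : ℝ :=
  if R = Finset.univ then P.a else P.b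

theorem cast_d_sub_one (P : HSBMParams) : ((P.d - 1 : ℕ) : ℝ) = (P.d : ℝ) - 1 := by
  rw [Nat.cast_sub (by have := P.three_le_d; omega), Nat.cast_one]

theorem d_sub_one_pos (P : HSBMParams) : (0 : ℝ) < (P.d : ℝ) - 1 := by
  have h3 : (3 : ℝ) ≤ P.d := by exact_mod_cast P.three_le_d
  linarith

theorem edgeMean_pos (P : HSBMParams) : 0 < P.edgeMean := div_pos P.alpha_pos P.d_sub_one_pos

theorem a_pos (P : HSBMParams) : 0 < P.a := P.b_pos.trans_le P.b_le_a

theorem edgeWeight_pos (P : HSBMParams) (R : Finset (Fin (P.d - 1))) : 0 < P.edgeWeight R := by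
  unfold edgeWeight; split_ifs; exacts [P.a_pos, P.b_pos]

/-- The binomial coefficient in the type probability cancels against the uniform choice of `r`
children, so only whether all children agree matters. -/
theorem agreeLaw_apply (P : HSBMParams) (R : Finset (Fin (P.d - 1))) :
    P.agreeLaw R = ENNReal.ofReal (P.edgeWeight R / (P.edgeMean * 2 ^ (P.d - 1))) := by
  have hd : P.d - 1 < P.d := by have := P.three_le_d; omega
  have hR : R.card ≤ P.d - 1 := (Finset.card_le_univ R).trans_eq (Fintype.card_fin _)
  rw [agreeLaw, PMF.bind_apply, tsum_fintype,
    Finset.sum_eq_single (⟨R.card, hR.trans_lt hd⟩ : Fin P.d)]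
  · rw [PMF.uniformOfFinset_apply_of_mem _ (by simp), Finset.card_powersetCard, Finset.card_univ,
      Fintype.card_fin, typeLaw, PMF.ofFintype_apply]
    have hch : (0 : ℝ) < ((P.d - 1).choose R.card : ℕ) := by exact_mod_cast Nat.choose_pos hR
    rw [← ENNReal.ofReal_natCast, ← ENNReal.ofReal_inv_of_pos hch,
      ← ENNReal.ofReal_mul (P.typeProb_nonneg _)]
    congr 1
    have hR' : R.card = P.d - 1 ↔ R = Finset.univ := by
      rw [← Finset.card_eq_iff_eq_univ, Fintype.card_fin]
    have h1 := P.alpha_pos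
    have h2 := P.d_sub_one_pos
    simp only [typeProb, edgeWeight, edgeMean, hR']
    split_ifs with h
    · rw [hR'.2 h, Nat.choose_self]; field_simp; simp
    · field_simp
  · intro r _ hr
    rw [PMF.uniformOfFinset_apply_of_notMem, mul_zero]
    rw [Finset.mem_powersetCard]
    rintro ⟨-, h⟩
    exact hr (Fin.ext h.symm)
  · simp

instance : IsProbabilityMeasure P.growthLaw := by unfold growthLaw; infer_instance

theorem growthClass_eq_pi (P : HSBMParams) (l : ℕ) (ω : P.Growth) :
    P.growthClass l ω = Set.pi (P.internalFin l ω : Set P.Address) fun v =>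
      {(ω v).1} ×ˢ Set.pi (Finset.range (ω v).1 : Set ℕ) fun k => {(ω v).2 k} := by
  ext ω'
  simp [growthClass, Set.mem_pi]

theorem measurableSet_growthClass (P : HSBMParams) (l : ℕ) (ω : P.Growth) :
    MeasurableSet (P.growthClass l ω) := by
  rw [growthClass_eq_pi]
  exact .pi (Finset.countable_toSet _) fun v _ => (measurableSet_singleton _).prod
    (.pi (Finset.countable_toSet _) fun k _ => measurableSet_singleton _)

/-- A class is a finite cylinder. The Poisson factor `edgeMean ^ K` cancels against the `edgeMean`
in the denominators of the `K` agreement probabilities. -/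
theorem growthLaw_growthClass (P : HSBMParams) (l : ℕ) (ω : P.Growth) :
    P.growthLaw (P.growthClass l ω) = ENNReal.ofReal (∏ v ∈ P.internalFin l ω,
      (Real.exp (-P.edgeMean) / ((ω v).1.factorial : ℝ) *
        ∏ k ∈ Finset.range (ω v).1, P.edgeWeight ((ω v).2 k) / 2 ^ (P.d - 1))) := by
  have hm := P.edgeMean_pos
  rw [growthClass_eq_pi, growthLaw, Measure.infinitePi_pi, ENNReal.ofReal_prod_of_nonneg]
  · refine Finset.prod_congr rfl fun v _ => ?_
    rw [Measure.prod_prod, Measure.infinitePi_pi _ fun k _ => measurableSet_singleton _,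
      poissonMeasure_singleton]
    have : ∀ k ∈ Finset.range (ω v).1, P.agreeLaw.toMeasure {(ω v).2 k} =
        ENNReal.ofReal (P.edgeWeight ((ω v).2 k) / (P.edgeMean * 2 ^ (P.d - 1))) := fun k _ => by
      rw [PMF.toMeasure_apply_singleton _ _ (measurableSet_singleton _), agreeLaw_apply]
    rw [Finset.prod_congr rfl this, ← ENNReal.ofReal_prod_of_nonneg, ← ENNReal.ofReal_mul]
    · congr 1
      change Real.exp (-((P.edgeMean.toNNReal : NNReal) : ℝ)) * _ / _ * _ = _
      rw [show (P.alpha / ((P.d : ℝ) - 1)).toNNReal = P.edgeMean.toNNReal from rfl,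
        Real.coe_toNNReal _ hm.le]
      have : ∀ k, P.edgeWeight ((ω v).2 k) / (P.edgeMean * 2 ^ (P.d - 1)) =
          P.edgeWeight ((ω v).2 k) / 2 ^ (P.d - 1) * P.edgeMean⁻¹ := fun k => by
        field_simp
      simp only [this, Finset.prod_mul_distrib, Finset.prod_const, Finset.card_range]
      have hk : P.edgeMean ^ (ω v).1 * P.edgeMean⁻¹ ^ (ω v).1 = 1 := by
        rw [← mul_pow, mul_inv_cancel₀ hm.ne', one_pow]
      rw [div_mul_eq_mul_div, mul_div_right_comm]
      linear_combination (Real.exp (-P.edgeMean) / ((ω v).1.factorial : ℝ) *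
        ∏ k ∈ Finset.range (ω v).1, P.edgeWeight ((ω v).2 k) / 2 ^ (P.d - 1)) * hk
    · positivity
    · intro k _
      have := P.edgeWeight_pos ((ω v).2 k)
      positivity
  · intro v _
    have : 0 ≤ ∏ k ∈ Finset.range (ω v).1, P.edgeWeight ((ω v).2 k) / 2 ^ (P.d - 1) :=
      Finset.prod_nonneg fun k _ => div_nonneg (P.edgeWeight_pos _).le (by positivity)
    positivity
  · exact fun v _ => (measurableSet_singleton _).prod
      (.pi (Finset.countable_toSet _) fun k _ => measurableSet_singleton _)

/-! ### The expected size of the truncated hypertree -/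

/-- The tail sum is the mean, and the mean follows from m·P(m) = r·P(m-1). -/
theorem tsum_poissonMeasure_Ioi (r : NNReal) :
    ∑' k : ℕ, poissonMeasure r (Set.Ioi k) = r := by
  have h1 : ∀ k : ℕ, poissonMeasure r (Set.Ioi k) =
      ∑' m : ℕ, (Set.Ioi k).indicator (fun m => poissonMeasure r {m}) m := fun k => by
    exact (Measure.tsum_indicator_apply_singleton _ _ measurableSet_Ioi).symm
  simp only [h1]
  rw [ENNReal.tsum_comm]
  have h2 : ∀ m : ℕ, ∑' k : ℕ, (Set.Ioi k).indicator (fun m => poissonMeasure r {m}) m =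
      m * poissonMeasure r {m} := fun m => by
    rw [tsum_eq_sum (s := Finset.range m)]
    · rw [Finset.sum_congr rfl fun k hk => Set.indicator_of_mem
        (show m ∈ Set.Ioi k from Finset.mem_range.1 hk) _]
      simp
    · intro k hk
      exact Set.indicator_of_notMem (fun h => hk (Finset.mem_range.2 h)) _
  simp only [h2]
  rw [tsum_eq_zero_add' ENNReal.summable]
  have h3 : ∀ m : ℕ, ((m + 1 : ℕ) : ℝ≥0∞) * poissonMeasure r {m + 1} =
      r * poissonMeasure r {m} := fun m => by
    rw [poissonMeasure_singleton, poissonMeasure_singleton, ← ENNReal.ofReal_natCast,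
      ← ENNReal.ofReal_mul (by positivity), ← ENNReal.ofReal_coe_nnreal,
      ← ENNReal.ofReal_mul (by positivity)]
    congr 1
    rw [Nat.factorial_succ, pow_succ]
    push_cast
    field_simp
  simp only [h3]
  rw [ENNReal.tsum_mul_left]
  have h4 : ∑' m : ℕ, poissonMeasure r {m} = 1 := by
    simpa using Measure.tsum_indicator_apply_singleton (poissonMeasure r) Set.univ .univ
  simp [h4]

/-- The probability that a vertex generates a `k`-th hyperedge. -/
noncomputable def edgeTail (P : HSBMParams) (p : ℕ × Fin (P.d - 1)) : ℝ≥0∞ :=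
  poissonMeasure P.edgeMean.toNNReal (Set.Ioi p.1)

theorem tsum_edgeTail (P : HSBMParams) : ∑' p, P.edgeTail p = ENNReal.ofReal P.alpha := by
  simp only [edgeTail]
  rw [ENNReal.tsum_prod']
  simp only [tsum_fintype, Finset.sum_const, Finset.card_univ, Fintype.card_fin, nsmul_eq_mul]
  rw [ENNReal.tsum_mul_left, tsum_poissonMeasure_Ioi, ← ENNReal.ofReal_natCast]
  change _ * ENNReal.ofReal P.edgeMean = _
  rw [← ENNReal.ofReal_mul (by positivity), cast_d_sub_one, edgeMean]
  congr 1
  have := P.d_sub_one_pos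
  field_simp

/-- A vertex is present when each proper ancestor generates enough hyperedges. The length condition
in the induction shows that a new parent is a new coordinate, so independence gives a product. -/
theorem exists_present_eq_pi (P : HSBMParams) (v : P.Address) :
    ∃ (S : Finset P.Address) (t : P.Address → Set (ℕ × (ℕ → Finset (Fin (P.d - 1))))),
      (∀ u ∈ S, u.length < v.length) ∧ (∀ u, MeasurableSet (t u)) ∧
      {ω | P.present ω v} = Set.pi (S : Set P.Address) t ∧
      ∏ u ∈ S, (poissonMeasure (P.alpha / ((P.d : ℝ) - 1)).toNNReal).prod
        (Measure.infinitePi fun _ : ℕ => P.agreeLaw.toMeasure) (t u) =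
        (v.map P.edgeTail).prod := by
  classical
  induction v with
  | nil => exact ⟨∅, fun _ => Set.univ, by simp, fun _ => .univ, by simp [present], by simp⟩
  | cons p v ih =>
    obtain ⟨S, t, hS, ht, hpi, hprod⟩ := ih
    have hv : v ∉ S := fun h => lt_irrefl _ (hS v h)
    refine ⟨insert v S, Function.update t v (Set.Ioi p.1 ×ˢ Set.univ), ?_, ?_, ?_, ?_⟩
    · intro u hu
      rcases Finset.mem_insert.1 hu with rfl | h
      · simp
      · exact (hS u h).trans (by simp)
    · intro u
      by_cases h : u = v
      · subst h; simp only [Function.update_self]; exact measurableSet_Ioi.prod .univ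
      · rw [Function.update_of_ne h]; exact ht u
    · have h1 : Set.pi (S : Set P.Address) (Function.update t v (Set.Ioi p.1 ×ˢ Set.univ)) =
          Set.pi (S : Set P.Address) t :=
        Set.pi_congr rfl fun u hu => Function.update_of_ne (fun h => hv (by rw [← h]; exact hu)) _ _
      rw [Finset.coe_insert, Set.insert_pi, h1, ← hpi]
      ext ω
      obtain ⟨k, j⟩ := p
      simp [present, and_comm]
    · rw [Finset.prod_insert hv, List.map_cons, List.prod_cons, ← hprod, Function.update_self,
        Measure.prod_prod, measure_univ, mul_one]
      congr 1
      refine Finset.prod_congr rfl fun u hu => ?_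
      rw [Function.update_of_ne (fun h => hv (by rw [← h]; exact hu))]

theorem measurableSet_present (P : HSBMParams) (v : P.Address) :
    MeasurableSet {ω : P.Growth | P.present ω v} := by
  obtain ⟨S, t, -, ht, hpi, -⟩ := P.exists_present_eq_pi v
  rw [hpi]
  exact .pi (Finset.countable_toSet _) fun u _ => ht u

theorem growthLaw_present (P : HSBMParams) (v : P.Address) :
    P.growthLaw {ω | P.present ω v} = (v.map P.edgeTail).prod := by
  obtain ⟨S, t, -, ht, hpi, hprod⟩ := P.exists_present_eq_pi v
  rw [hpi, growthLaw, Measure.infinitePi_pi _ fun u _ => ht u, hprod]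

theorem _root_.ENNReal.tsum_list_map_prod {A : Type*} (q : A → ℝ≥0∞) (m : ℕ) :
    ∑' v : List A, (if v.length = m then (v.map q).prod else 0) = (∑' p, q p) ^ m := by
  induction m with
  | zero =>
    rw [tsum_eq_single []]
    · simp
    · intro v hv
      simp [hv]
  | succ m ih =>
    have hinj : Function.Injective fun z : A × List A => z.1 :: z.2 := by
      rintro ⟨p, v⟩ ⟨p', v'⟩ h
      simpa using h
    rw [← hinj.tsum_eq, ENNReal.tsum_prod', pow_succ', ← ih, ← ENNReal.tsum_mul_right]
    · refine tsum_congr fun p => ?_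
      rw [← ENNReal.tsum_mul_left]
      refine tsum_congr fun v => ?_
      simp
    · intro v hv
      rcases v with _ | ⟨p, v⟩
      · simp at hv
      · exact ⟨(p, v), rfl⟩

/-- Summing the presence probabilities over words of length m factorizes into the m-th power of the
sum over one letter, which is α. -/
theorem lintegral_card_nodeFin (P : HSBMParams) (l : ℕ) :
    ∫⁻ ω, ((P.nodeFin l ω).card : ℝ≥0∞) ∂P.growthLaw =
      ∑ m ∈ Finset.range (l + 1), ENNReal.ofReal P.alpha ^ m := by
  classical
  have h1 : ∀ ω, ((P.nodeFin l ω).card : ℝ≥0∞) =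
      ∑' v : P.Address, ({ω' | v ∈ P.nodes l ω'} : Set P.Growth).indicator
        (1 : P.Growth → ℝ≥0∞) ω := fun ω => by
    simp only [Set.indicator_apply, Set.mem_ofPred_eq, ← mem_nodeFin, Pi.one_apply]
    rw [tsum_eq_sum (s := P.nodeFin l ω) fun v hv => if_neg hv, Finset.sum_ite_mem]
    simp
  have h2 : ∀ v : P.Address, MeasurableSet {ω' : P.Growth | v ∈ P.nodes l ω'} := fun v =>
    (P.measurableSet_present v).inter (.const _)
  simp only [h1]
  rw [lintegral_tsum fun v => (measurable_one.indicator (h2 v)).aemeasurable]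
  simp only [lintegral_indicator_one (h2 _), ← P.tsum_edgeTail, ← ENNReal.tsum_list_map_prod]
  rw [← Summable.tsum_finsetSum fun _ _ => ENNReal.summable]
  refine tsum_congr fun v => ?_
  rw [Finset.sum_ite_eq]
  by_cases hv : v.length ≤ l
  · rw [if_pos (by simp; omega), ← growthLaw_present]
    congr 1
    ext ω
    simp [nodes, hv]
  · rw [if_neg (by simp; omega)]
    simp [nodes, hv]

end HSBMParams

/-! ### Counting labellings and sorted labellings -/

/-- The entries of an injective matrix can be permuted, within rows and by exchanging rows, such
that the rows and the first column are increasing. -/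
theorem exists_perm_strictMono_rows {α : Type*} [LinearOrder α] {K r : ℕ} (hr : 0 < r)
    (m : Fin K → Fin r → α) (hm : ∀ k j k' j', m k j = m k' j' → k = k' ∧ j = j') :
    ∃ (π : Equiv.Perm (Fin K)) (ρ : Fin K → Equiv.Perm (Fin r)),
      (∀ k, StrictMono fun j => m (π k) (ρ k j)) ∧
      StrictMono fun k => m (π k) (ρ k ⟨0, hr⟩) := by
  let ρ' : Fin K → Equiv.Perm (Fin r) := fun k => Tuple.sort (m k)
  let f : Fin K → α := fun k => m k (ρ' k ⟨0, hr⟩)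
  refine ⟨Tuple.sort f, fun k => ρ' (Tuple.sort f k), fun k => ?_, ?_⟩
  · exact (Tuple.monotone_sort (m (Tuple.sort f k))).strictMono_of_injective
      fun j j' h => (ρ' _).injective (hm _ _ _ _ h).2
  · exact (Tuple.monotone_sort f).strictMono_of_injective
      fun k k' h => (Tuple.sort f).injective (hm _ _ _ _ h).1

namespace HSBMParams

variable {P : HSBMParams} {l : ℕ} {ω : P.Growth} {n : ℕ}

/-- The root as an element of the set of vertices of the truncated hypertree. -/
noncomputable def rootNode (P : HSBMParams) (l : ℕ) (ω : P.Growth) : P.nodeFin l ω :=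
  ⟨[], mem_nodeFin.2 (P.nil_mem_nodes l ω)⟩

/-- A child of an inner vertex as an element of the set of vertices of the truncated hypertree. -/
noncomputable def childNode (v : P.internalFin l ω) (k : Fin (ω v).1) (j : Fin (P.d - 1)) :
    P.nodeFin l ω :=
  ⟨((k : ℕ), j) :: v.1, mem_nodeFin.2 (cons_mem_nodes.2 ⟨mem_internalFin.1 v.2, k.2⟩)⟩

theorem eq_rootNode_or_childNode (w : P.nodeFin l ω) :
    w = P.rootNode l ω ∨ ∃ v k j, w = childNode v k j := by
  obtain ⟨w, hw⟩ := w
  rcases w with _ | ⟨⟨k, j⟩, v⟩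
  · exact Or.inl rfl
  · have := cons_mem_nodes.1 (mem_nodeFin.1 hw)
    exact Or.inr ⟨⟨v, mem_internalFin.2 this.1⟩, ⟨k, this.2⟩, j, rfl⟩

theorem childNode_injective {v v' : P.internalFin l ω} {k : Fin (ω v).1} {k' : Fin (ω v').1}
    {j j' : Fin (P.d - 1)} (h : childNode v k j = childNode v' k' j') :
    v = v' ∧ (k : ℕ) = k' ∧ j = j' := by
  have h' := congrArg Subtype.val h
  simp only [childNode, List.cons.injEq, Prod.mk.injEq] at h'
  exact ⟨Subtype.ext h'.2, h'.1.1, h'.1.2⟩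

/-- Labels of the vertices of the truncated hypertree, extended by a constant. -/
noncomputable def labelExt (i : Fin n) (ψ : P.nodeFin l ω → Fin n) : P.Address → Fin n := fun v =>
  open scoped Classical in if h : v ∈ P.nodeFin l ω then ψ ⟨v, h⟩ else i

theorem labelExt_coe (i : Fin n) (ψ : P.nodeFin l ω → Fin n) (w : P.nodeFin l ω) :
    labelExt i ψ w = ψ w := by
  simp [labelExt]

/-- Permutations, for each inner vertex, of its hyperedges and of the children in each of them. -/
abbrev Shuffle (P : HSBMParams) (l : ℕ) (ω : P.Growth) : Type :=
  (v : P.internalFin l ω) →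
    Equiv.Perm (Fin (ω v).1) × (Fin (ω v).1 → Equiv.Perm (Fin (P.d - 1)))

theorem card_shuffle (P : HSBMParams) (l : ℕ) (ω : P.Growth) :
    Fintype.card (P.Shuffle l ω) = ∏ v ∈ P.internalFin l ω,
      ((ω v).1.factorial * (P.d - 1).factorial ^ (ω v).1) := by
  rw [Fintype.card_pi, ← Finset.prod_coe_sort (P.internalFin l ω)
    fun v => (ω v).1.factorial * (P.d - 1).factorial ^ (ω v).1]
  refine Finset.prod_congr rfl fun (v : P.internalFin l ω) _ => ?_
  rw [Fintype.card_prod, Fintype.card_perm, Fintype.card_fin, Fintype.card_fun, Fintype.card_perm,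
    Fintype.card_fin, Fintype.card_fin]

/-- The action of a shuffle on the vertices. -/
noncomputable def Shuffle.map (g : P.Shuffle l ω) : P.nodeFin l ω → P.nodeFin l ω
  | ⟨[], h⟩ => ⟨[], h⟩
  | ⟨(k, j) :: v, h⟩ =>
    have hv := cons_mem_nodes.1 (mem_nodeFin.1 h)
    let v' : P.internalFin l ω := ⟨v, mem_internalFin.2 hv.1⟩
    childNode v' ((g v').1 ⟨k, hv.2⟩) ((g v').2 ⟨k, hv.2⟩ j)

theorem Shuffle.map_childNode (g : P.Shuffle l ω) (v : P.internalFin l ω) (k : Fin (ω v).1)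
    (j : Fin (P.d - 1)) :
    g.map (childNode v k j) = childNode v ((g v).1 k) ((g v).2 k j) := rfl

theorem Shuffle.map_rootNode (g : P.Shuffle l ω) : g.map (P.rootNode l ω) = P.rootNode l ω := rfl

theorem Shuffle.map_surjective (g : P.Shuffle l ω) : Function.Surjective g.map := by
  intro w
  rcases eq_rootNode_or_childNode w with rfl | ⟨v, k, j, rfl⟩
  · exact ⟨_, g.map_rootNode⟩
  · refine ⟨childNode v ((g v).1.symm k) (((g v).2 ((g v).1.symm k)).symm j), ?_⟩
    rw [g.map_childNode]
    simp

/-- The injective labellings with root label `i`. -/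
noncomputable def rootedLabelings (P : HSBMParams) (l : ℕ) (ω : P.Growth) (i : Fin n) :
    Finset (P.nodeFin l ω → Fin n) :=
  open scoped Classical in
  Finset.univ.filter fun ψ => Function.Injective ψ ∧ ψ (P.rootNode l ω) = i

/-- The increasing injective labellings with root label `i`. -/
noncomputable def sortedLabelings (P : HSBMParams) (l : ℕ) (ω : P.Growth) (i : Fin n) :
    Finset (P.nodeFin l ω → Fin n) :=
  open scoped Classical in
  (P.rootedLabelings l ω i).filter fun ψ => P.SortedLabels l ω (labelExt i ψ)

theorem mem_rootedLabelings {i : Fin n} {ψ : P.nodeFin l ω → Fin n} :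
    ψ ∈ P.rootedLabelings l ω i ↔ Function.Injective ψ ∧ ψ (P.rootNode l ω) = i := by
  simp [rootedLabelings]

theorem mem_sortedLabelings {i : Fin n} {ψ : P.nodeFin l ω → Fin n} :
    ψ ∈ P.sortedLabelings l ω i ↔ (Function.Injective ψ ∧ ψ (P.rootNode l ω) = i) ∧
      P.SortedLabels l ω (labelExt i ψ) := by
  simp [sortedLabelings, mem_rootedLabelings]

/-- Sortedness at a vertex involves only the labels of its children, so every sibling family can be
sorted on its own. Descendants keep their addresses; the shuffle need not be a tree automorphism. -/
theorem exists_shuffle_sorted (i : Fin n) (ψ : P.nodeFin l ω → Fin n)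
    (hψ : Function.Injective ψ) :
    ∃ g : P.Shuffle l ω, P.SortedLabels l ω (labelExt i (ψ ∘ g.map)) := by
  have key := fun v : P.internalFin l ω =>
    exists_perm_strictMono_rows P.one_le_d_sub_one (fun k j => ψ (childNode v k j))
      fun k j k' j' h => ⟨Fin.ext (childNode_injective (hψ h)).2.1, (childNode_injective (hψ h)).2.2⟩
  choose π ρ h1 h2 using key
  refine ⟨fun v => (π v, ρ v), fun v hv => ?_⟩
  set g : P.Shuffle l ω := fun v => (π v, ρ v)
  let v' : P.internalFin l ω := ⟨v, mem_internalFin.2 hv⟩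
  have hval : ∀ (k : Fin (ω v).1) (j : Fin (P.d - 1)),
      labelExt i (ψ ∘ g.map) (((k : ℕ), j) :: v) = ψ (childNode v' (π v' k) (ρ v' k j)) :=
    fun k j => labelExt_coe i (ψ ∘ g.map) (childNode v' k j)
  refine ⟨fun k hk j j' hj => ?_, fun k k' hkk hk' => ?_⟩
  · have := h1 v' ⟨k, hk⟩ hj
    simp only [← hval] at this
    exact this
  · have := h2 v' (show (⟨k, hkk.trans hk'⟩ : Fin (ω v).1) < ⟨k', hk'⟩ from hkk)
    simp only [← hval] at this
    exact this

/-- Sorting a labelling and remembering the shuffle is injective, because a shuffle acts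
surjectively on the vertices. -/
theorem card_rootedLabelings_le (P : HSBMParams) (l : ℕ) (ω : P.Growth) (i : Fin n) :
    (P.rootedLabelings l ω i).card ≤ (P.sortedLabelings l ω i).card *
      ∏ v ∈ P.internalFin l ω, ((ω v).1.factorial * (P.d - 1).factorial ^ (ω v).1) := by
  classical
  have key : ∀ ψ : P.nodeFin l ω → Fin n, ∃ g : P.Shuffle l ω,
      ψ ∈ P.rootedLabelings l ω i → P.SortedLabels l ω (labelExt i (ψ ∘ g.map)) := by
    intro ψ
    by_cases h : ψ ∈ P.rootedLabelings l ω i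
    · obtain ⟨g, hg⟩ := exists_shuffle_sorted i ψ (mem_rootedLabelings.1 h).1
      exact ⟨g, fun _ => hg⟩
    · exact ⟨fun v => (1, fun _ => 1), fun h' => absurd h' h⟩
  choose g hg using key
  rw [← card_shuffle, ← Finset.card_univ, ← Finset.card_product]
  refine Finset.card_le_card_of_injOn (fun ψ => (ψ ∘ (g ψ).map, g ψ)) ?_ ?_
  · intro ψ hψ
    have h := mem_rootedLabelings.1 hψ
    simp only [Finset.coe_product, Set.mem_prod, Finset.mem_coe, Finset.mem_univ, and_true,
      mem_sortedLabelings]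
    refine ⟨⟨h.1.comp (Finite.injective_iff_surjective.2 (g ψ).map_surjective), ?_⟩, hg ψ hψ⟩
    rw [Function.comp_apply, Shuffle.map_rootNode, h.2]
  · intro ψ _ ψ' _ h
    simp only [Prod.mk.injEq] at h
    rw [h.2] at h
    exact (g ψ').map_surjective.injective_comp_right h.1

/-- With the root label fixed, V - 1 distinct labels are chosen among n - 1. Each factor of this
falling factorial is at least n + 1 - V. -/
theorem pow_le_card_rootedLabelings (P : HSBMParams) (l : ℕ) (ω : P.Growth) (i : Fin n) :
    (n + 1 - (P.nodeFin l ω).card) ^ ((P.d - 1) * (P.edgeFin l ω).card) ≤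
      (P.rootedLabelings l ω i).card := by
  classical
  have hn : 0 < n := i.pos
  have hcard := P.card_nodeFin l ω
  have h1 : Fintype.card ({w : P.nodeFin l ω // w ≠ P.rootNode l ω} ↪ {y : Fin n // y ≠ i}) ≤
      (P.rootedLabelings l ω i).card := by
    rw [← Finset.card_univ]
    refine Finset.card_le_card_of_injOn
      (fun e w => if h : w = P.rootNode l ω then i else e ⟨w, h⟩) ?_ ?_
    · intro e _
      rw [Finset.mem_coe, mem_rootedLabelings]
      refine ⟨fun w w' h => ?_, by simp⟩
      by_cases hw : w = P.rootNode l ω <;> by_cases hw' : w' = P.rootNode l ω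
      · rw [hw, hw']
      · simp only [hw, hw', dite_true, dite_false] at h
        exact absurd h.symm (e _).2
      · simp only [hw, hw', dite_true, dite_false] at h
        exact absurd h (e _).2
      · simp only [hw, hw', dite_false] at h
        exact congrArg Subtype.val (e.injective (Subtype.ext h))
    · intro e _ e' _ h
      ext w
      have := congrFun h w.1
      simp only [w.2, dite_false] at this
      exact congrArg Fin.val this
  refine le_trans ?_ h1
  rw [Fintype.card_embedding_eq, Fintype.card_subtype_compl, Fintype.card_subtype_compl]
  simp only [Fintype.card_fin, Fintype.card_unique, Fintype.card_coe]
  have h2 := Nat.pow_sub_le_descFactorial (n - 1) ((P.nodeFin l ω).card - 1)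
  have h3 : (P.nodeFin l ω).card - 1 = (P.d - 1) * (P.edgeFin l ω).card := by omega
  rw [← h3]
  refine le_trans (Nat.pow_le_pow_left ?_ _) h2
  omega

end HSBMParams

/-! ### Counting spins and hyperedges -/

theorem card_filter_spin_eqOn {n : ℕ} (W : Finset (Fin n)) (τ : Fin n → ℤˣ) :
    (Finset.univ.filter fun σ : Fin n → ℤˣ => ∀ u ∈ W, σ u = τ u).card = 2 ^ (n - W.card) := by
  classical
  have h : (Finset.univ.filter fun σ : Fin n → ℤˣ => ∀ u ∈ W, σ u = τ u) =
      Fintype.piFinset fun u => if u ∈ W then {τ u} else Finset.univ := by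
    ext σ
    simp only [Finset.mem_filter, Finset.mem_univ, true_and, Fintype.mem_piFinset]
    refine forall_congr' fun u => ?_
    by_cases hu : u ∈ W <;> simp [hu, Int.units_eq_one_or]
  have h2 : (Finset.univ : Finset ℤˣ).card = 2 := rfl
  rw [h, Fintype.card_piFinset]
  simp only [apply_ite Finset.card, Finset.card_singleton, h2]
  rw [Finset.prod_ite, Finset.prod_const_one, one_mul, Finset.prod_const]
  congr 1
  rw [Finset.filter_not, Finset.card_sdiff]
  simp

theorem card_filter_mem_le {n d D : ℕ} (hD : D = d + 1) (u : Fin n) :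
    (Finset.univ.filter fun e : {e : Finset (Fin n) // e.card = D} => u ∈ e.1).card ≤
      n.choose d := by
  classical
  subst hD
  calc _ ≤ (Finset.powersetCard d (Finset.univ : Finset (Fin n))).card := by
        refine Finset.card_le_card_of_injOn (fun e => e.1.erase u) ?_ ?_
        · intro e he
          have hu : u ∈ e.1 := by simpa using he
          simp [Finset.card_erase_of_mem hu, e.2]
        · intro e he e' he' h
          have hu : u ∈ e.1 := by simpa using he
          have hu' : u ∈ e'.1 := by simpa using he'
          simp only at h
          rw [Subtype.ext_iff, ← Finset.insert_erase hu, h, Finset.insert_erase hu']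
    _ = _ := by simp

theorem card_filter_mem_mem_le {n d D : ℕ} (hD : D = d + 2) {u w : Fin n} (huw : u ≠ w) :
    (Finset.univ.filter fun e : {e : Finset (Fin n) // e.card = D} =>
      u ∈ e.1 ∧ w ∈ e.1).card ≤ n.choose d := by
  classical
  subst hD
  calc _ ≤ (Finset.powersetCard d (Finset.univ : Finset (Fin n))).card := by
        refine Finset.card_le_card_of_injOn (fun e => (e.1.erase u).erase w) ?_ ?_
        · intro e he
          have hu : u ∈ e.1 ∧ w ∈ e.1 := by simpa using he
          have hw : w ∈ e.1.erase u := Finset.mem_erase.2 ⟨huw.symm, hu.2⟩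
          simp [Finset.card_erase_of_mem hu.1, Finset.card_erase_of_mem hw, e.2]
        · intro e he e' he' h
          have hu : u ∈ e.1 ∧ w ∈ e.1 := by simpa using he
          have hu' : u ∈ e'.1 ∧ w ∈ e'.1 := by simpa using he'
          have hw : w ∈ e.1.erase u := Finset.mem_erase.2 ⟨huw.symm, hu.2⟩
          have hw' : w ∈ e'.1.erase u := Finset.mem_erase.2 ⟨huw.symm, hu'.2⟩
          simp only at h
          rw [Subtype.ext_iff, ← Finset.insert_erase hu.1, ← Finset.insert_erase hw, h,
            Finset.insert_erase hw', Finset.insert_erase hu'.1]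
    _ = _ := by simp

/-- Prescribing a second vertex of a hyperedge costs a factor of order 1/n; this is the source of
the V²/n error. -/
theorem mul_choose_le {n r : ℕ} (hr : 1 ≤ r) (hn : 2 * r ≤ n) :
    n * n.choose (r - 1) ≤ 2 * r * n.choose r := by
  obtain ⟨m, rfl⟩ : ∃ m, r = m + 1 := ⟨r - 1, by omega⟩
  have h := Nat.choose_succ_right_eq n m
  rw [Nat.add_sub_cancel]
  calc n * n.choose m ≤ (2 * (n - m)) * n.choose m := Nat.mul_le_mul_right _ (by omega)
    _ = 2 * (n.choose m * (n - m)) := by ring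
    _ = 2 * (m + 1) * n.choose (m + 1) := by rw [← h]; ring

/-! ### Products of small perturbations of one -/

/-- Since log(1-p) ≥ 1 - 1/(1-p), it suffices that 1/(1-p) ≤ 1 + p + 2p², which amounts to p²(1-2p)
≥ 0. -/
theorem exp_neg_le_one_sub {p : ℝ} (h0 : 0 ≤ p) (h1 : p ≤ 1 / 2) :
    Real.exp (-(p + 2 * p ^ 2)) ≤ 1 - p := by
  have hp : 0 < 1 - p := by linarith
  rw [← Real.le_log_iff_exp_le hp]
  have h := Real.one_sub_inv_le_log_of_pos hp
  refine le_trans ?_ h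
  have : (1 - p)⁻¹ ≤ 1 + p + 2 * p ^ 2 := by
    rw [inv_le_iff_one_le_mul₀ hp]
    nlinarith [mul_nonneg (mul_nonneg h0 h0) (by linarith : 0 ≤ 1 - 2 * p)]
  linarith

/-- Jensen's inequality for averages of products of factors `1 - p`. -/
theorem mul_exp_le_sum_prod_one_sub {A B : Type*} (S : Finset A) (F : Finset B) (p : A → B → ℝ)
    (h0 : ∀ x ∈ S, ∀ e ∈ F, 0 ≤ p x e) (h1 : ∀ x ∈ S, ∀ e ∈ F, p x e ≤ 1 / 2) {Z : ℝ}
    (hZ : ∑ x ∈ S, ∑ e ∈ F, (p x e + 2 * p x e ^ 2) ≤ S.card * Z) :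
    S.card * Real.exp (-Z) ≤ ∑ x ∈ S, ∏ e ∈ F, (1 - p x e) := by
  rcases S.eq_empty_or_nonempty with rfl | hS
  · simp
  have hN : (0 : ℝ) < S.card := by exact_mod_cast hS.card_pos
  have hw : ∑ _x ∈ S, (S.card : ℝ)⁻¹ = 1 := by
    rw [Finset.sum_const, nsmul_eq_mul, mul_inv_cancel₀ hN.ne']
  have hJ := convexOn_exp.map_sum_le (t := S) (w := fun _ => (S.card : ℝ)⁻¹)
    (p := fun x => -∑ e ∈ F, (p x e + 2 * p x e ^ 2)) (fun _ _ => by positivity) hw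
    (fun _ _ => Set.mem_univ _)
  simp only [smul_eq_mul, ← Finset.mul_sum] at hJ
  have h2 : -Z ≤ (S.card : ℝ)⁻¹ * ∑ x ∈ S, -∑ e ∈ F, (p x e + 2 * p x e ^ 2) := by
    rw [Finset.sum_neg_distrib, mul_neg, neg_le_neg_iff, inv_mul_le_iff₀ hN]
    exact hZ
  have h3 := (Real.exp_le_exp.2 h2).trans hJ
  rw [← mul_le_mul_iff_right₀ hN, mul_inv_cancel_left₀ hN.ne'] at h3
  refine h3.trans (Finset.sum_le_sum fun x hx => ?_)
  rw [← Finset.sum_neg_distrib, Real.exp_sum]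
  exact Finset.prod_le_prod (fun _ _ => (Real.exp_pos _).le)
    fun e he => exp_neg_le_one_sub (h0 x hx e he) (h1 x hx e he)

namespace HSBMParams

/-! ### The law of the stochastic block model -/

instance : MeasurableSingletonClass ℤˣ where
  measurableSet_singleton u := by
    refine ⟨{(u : ℤ)}, measurableSet_singleton _, ?_⟩
    ext v
    simp [Units.ext_iff]

theorem spinLaw_singleton {n : ℕ} (σ : Fin n → ℤˣ) :
    spinLaw n {σ} = ENNReal.ofReal ((1 / 2) ^ n) := by
  rw [spinLaw, Measure.pi_singleton]
  have : ∀ u : ℤˣ, (PMF.uniformOfFintype ℤˣ).toMeasure {u} = ENNReal.ofReal (1 / 2) := fun u => by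
    rw [PMF.toMeasure_apply_singleton _ _ (measurableSet_singleton _), PMF.uniformOfFintype_apply,
      show Fintype.card ℤˣ = 2 from rfl, one_div, ENNReal.ofReal_inv_of_pos two_pos]
    simp
  simp only [this, Finset.prod_const, Finset.card_univ, Fintype.card_fin]
  rw [ENNReal.ofReal_pow (by norm_num)]

theorem hsbmLaw_apply (P : HSBMParams) (n : ℕ) (S : Set (P.Sample n)) :
    P.hsbmLaw n S = ∑ σ : Fin n → ℤˣ,
      ENNReal.ofReal ((1 / 2) ^ n) * P.edgeLaw n σ {T | (T, σ) ∈ S} := by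
  rw [hsbmLaw, Measure.finsetSum_apply]
  refine Finset.sum_congr rfl fun σ _ => ?_
  rw [Measure.smul_apply, smul_eq_mul, spinLaw_singleton,
    Measure.map_apply measurable_prodMk_right S.toFinite.measurableSet]
  rfl

instance (P : HSBMParams) (n : ℕ) (σ : Fin n → ℤˣ) : IsProbabilityMeasure (P.edgeLaw n σ) := by
  unfold edgeLaw; infer_instance

theorem hsbmLaw_spin_eq (P : HSBMParams) {n : ℕ} (i : Fin n) (s : ℤˣ) :
    P.hsbmLaw n {x | x.2 i = s} = ENNReal.ofReal (1 / 2) := by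
  classical
  rw [hsbmLaw_apply]
  have h1 : ∀ σ : Fin n → ℤˣ, ENNReal.ofReal ((1 / 2) ^ n) *
      P.edgeLaw n σ {T | (T, σ) ∈ {x : P.Sample n | x.2 i = s}} =
      if ∀ u ∈ ({i} : Finset (Fin n)), σ u = (fun _ => s) u then ENNReal.ofReal ((1 / 2) ^ n)
      else 0 := fun σ => by
    by_cases h : σ i = s <;> simp [h]
  simp only [h1]
  rw [← Finset.sum_filter, Finset.sum_const, card_filter_spin_eqOn, nsmul_eq_mul,
    ← ENNReal.ofReal_natCast, ← ENNReal.ofReal_mul (by positivity)]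
  congr 1
  obtain ⟨m, rfl⟩ : ∃ m, n = m + 1 := ⟨n - 1, by have := i.pos; omega⟩
  simp only [Finset.card_singleton, Nat.add_sub_cancel]
  push_cast
  rw [pow_succ, ← mul_assoc, ← mul_pow]
  norm_num

instance (P : HSBMParams) (n : ℕ) : IsFiniteMeasure (P.hsbmLaw n) := by
  refine ⟨?_⟩
  rw [hsbmLaw_apply]
  exact ENNReal.sum_lt_top.2 fun σ _ => ENNReal.mul_lt_top ENNReal.ofReal_lt_top
    (measure_lt_top _ _)

/-- The law of the stochastic block model conditioned on the spin of a vertex. -/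
noncomputable def condLaw (P : HSBMParams) {n : ℕ} (i : Fin n) (s : ℤˣ) : Measure (P.Sample n) :=
  ProbabilityTheory.cond (P.hsbmLaw n) {x | x.2 i = s}

instance (P : HSBMParams) {n : ℕ} (i : Fin n) (s : ℤˣ) :
    IsProbabilityMeasure (P.condLaw i s) := by
  refine cond_isProbabilityMeasure ?_
  rw [hsbmLaw_spin_eq]
  simp

theorem condLaw_apply (P : HSBMParams) {n : ℕ} (i : Fin n) (s : ℤˣ) (S : Set (P.Sample n))
    (hS : ∀ x ∈ S, x.2 i = s) :
    P.condLaw i s S = ∑ σ : Fin n → ℤˣ,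
      ENNReal.ofReal (2 * (1 / 2) ^ n) * P.edgeLaw n σ {T | (T, σ) ∈ S} := by
  rw [condLaw, cond_apply (Set.toFinite _).measurableSet, hsbmLaw_spin_eq,
    Set.inter_eq_right.2 (show S ⊆ {x | x.2 i = s} from hS), hsbmLaw_apply, Finset.mul_sum]
  refine Finset.sum_congr rfl fun σ _ => ?_
  rw [← mul_assoc, ← ENNReal.ofReal_inv_of_pos (by norm_num),
    ← ENNReal.ofReal_mul (by norm_num)]
  norm_num

theorem edgeProb_eq (P : HSBMParams) {n : ℕ} (hC : P.a ≤ n.choose (P.d - 1)) (σ : Fin n → ℤˣ)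
    (e : P.PotentialEdge n) [Decidable (∀ x ∈ e.1, ∀ y ∈ e.1, σ x = σ y)] :
    (P.edgeProb n σ e : ℝ) =
      (if ∀ x ∈ e.1, ∀ y ∈ e.1, σ x = σ y then P.a else P.b) / (n.choose (P.d - 1) : ℝ) := by
  have hC0 : (0 : ℝ) < n.choose (P.d - 1) := P.a_pos.trans_le hC
  rw [edgeProb, Set.coe_projIcc]
  have h1 : ∀ c : ℝ, 0 < c → c ≤ P.a →
      max 0 (min 1 (c / (n.choose (P.d - 1) : ℝ))) = c / (n.choose (P.d - 1) : ℝ) := by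
    intro c hc hca
    rw [min_eq_right ((div_le_one hC0).2 (hca.trans hC)), max_eq_right (by positivity)]
  split_ifs
  · exact h1 _ P.a_pos le_rfl
  · exact h1 _ P.b_pos P.b_le_a

theorem edgeLaw_pi (P : HSBMParams) {n : ℕ} (σ : Fin n → ℤˣ) (S F : Finset (P.PotentialEdge n))
    (hSF : Disjoint S F) :
    P.edgeLaw n σ {T | (∀ e ∈ S, T e = true) ∧ ∀ e ∈ F, T e = false} =
      ENNReal.ofReal ((∏ e ∈ S, (P.edgeProb n σ e : ℝ)) * ∏ e ∈ F, (1 - (P.edgeProb n σ e : ℝ))) := by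
  classical
  have h1 : {T : P.PotentialEdge n → Bool | (∀ e ∈ S, T e = true) ∧ ∀ e ∈ F, T e = false} =
      Set.pi Set.univ fun e =>
        if e ∈ S then {true} else if e ∈ F then {false} else Set.univ := by
    ext T
    simp only [Set.mem_ofPred_eq, Set.mem_pi, Set.mem_univ, true_imp_iff, ← forall_and]
    refine forall_congr' fun e => ?_
    have := fun h : e ∈ S => Finset.disjoint_left.1 hSF h
    by_cases h1 : e ∈ S <;> by_cases h2 : e ∈ F <;> simp_all
  have h2 : ∀ e, bernoulliMeasure true false (P.edgeProb n σ e)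
      (if e ∈ S then {true} else if e ∈ F then {false} else Set.univ) =
      ENNReal.ofReal ((if e ∈ S then (P.edgeProb n σ e : ℝ) else 1) *
        (if e ∈ F then (1 - (P.edgeProb n σ e : ℝ)) else 1)) := by
    intro e
    have := fun h : e ∈ S => Finset.disjoint_left.1 hSF h
    rw [← ofReal_measureReal]
    congr 1
    by_cases h1 : e ∈ S
    · simp [h1, this h1]
    · by_cases h2 : e ∈ F <;> simp [h1, h2]
  rw [h1, edgeLaw, Measure.pi_pi, Finset.prod_congr rfl fun e _ => h2 e,
    ← ENNReal.ofReal_prod_of_nonneg, Finset.prod_mul_distrib, Finset.prod_ite_mem,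
    Finset.prod_ite_mem, Finset.univ_inter, Finset.univ_inter]
  intro e _
  have h3 := unitInterval.nonneg (P.edgeProb n σ e)
  have h4 := unitInterval.le_one (P.edgeProb n σ e)
  refine mul_nonneg ?_ ?_ <;> split_ifs <;> linarith

end HSBMParams

/-! ### Mean number of forbidden hyperedges under random spins -/

namespace HSBMParams

variable {P : HSBMParams} {n : ℕ}

/-- The spin configurations which are equal to `τ` on `W`. -/
def spinsExtending (W : Finset (Fin n)) (τ : Fin n → ℤˣ) : Finset (Fin n → ℤˣ) :=
  Finset.univ.filter fun σ => ∀ u ∈ W, σ u = τ u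

/-- This form is the mean edge weight when d-1 spins are uniform: all agree with the given one with
probability 2^{-(d-1)}. It links the Poisson rate to the block model. -/
theorem edgeMean_eq (P : HSBMParams) :
    P.edgeMean = P.b + (P.a - P.b) / 2 ^ (P.d - 1) := by
  have := P.d_sub_one_pos
  rw [edgeMean, alpha]
  field_simp
  ring

theorem edgeProb_le (P : HSBMParams) (hC : P.a ≤ n.choose (P.d - 1)) (σ : Fin n → ℤˣ)
    (e : P.PotentialEdge n) : (P.edgeProb n σ e : ℝ) ≤ P.a / n.choose (P.d - 1) := by
  classical
  rw [P.edgeProb_eq hC]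
  gcongr
  split_ifs
  exacts [le_rfl, P.b_le_a]

/-- If exactly one vertex of `e` has a prescribed spin, the mean inclusion probability of `e` is
`edgeMean` divided by a binomial coefficient. -/
theorem sum_edgeProb_le (P : HSBMParams) (hC : P.a ≤ n.choose (P.d - 1)) (W : Finset (Fin n))
    (τ : Fin n → ℤˣ) (e : P.PotentialEdge n) {u : Fin n} (huW : u ∈ W) (hue : u ∈ e.1)
    (hclean : ∀ w ∈ W, w ∈ e.1 → w = u) :
    ∑ σ ∈ spinsExtending W τ, (P.edgeProb n σ e : ℝ) ≤
      (spinsExtending W τ).card * (P.edgeMean / n.choose (P.d - 1)) := by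
  classical
  have hC0 : (0 : ℝ) < n.choose (P.d - 1) := P.a_pos.trans_le hC
  have hinter : W ∩ e.1 = {u} := by
    ext w
    simp only [Finset.mem_inter, Finset.mem_singleton]
    exact ⟨fun h => hclean w h.1 h.2, fun h => h ▸ ⟨huW, hue⟩⟩
  have hunion : (W ∪ e.1).card = W.card + (P.d - 1) := by
    have := Finset.card_union_add_card_inter W e.1
    rw [hinter, Finset.card_singleton, e.2] at this
    have := P.three_le_d
    omega
  have hle : W.card + (P.d - 1) ≤ n := by
    rw [← hunion]; exact (Finset.card_le_univ _).trans_eq (Fintype.card_fin n)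
  -- A constant spin on `e` forces its d-1 vertices outside `W` to have the spin `τ u`.
  have hcount : ((spinsExtending W τ).filter
      fun σ => ∀ x ∈ e.1, ∀ y ∈ e.1, σ x = σ y).card ≤ 2 ^ (n - (W.card + (P.d - 1))) := by
    rw [← hunion, ← card_filter_spin_eqOn (W ∪ e.1) fun w => if w ∈ W then τ w else τ u]
    refine Finset.card_le_card fun σ hσ => ?_
    simp only [spinsExtending, Finset.mem_filter, Finset.mem_univ, true_and] at hσ ⊢
    intro w hw
    split_ifs with h
    · exact hσ.1 w h
    · rw [hσ.2 w ((Finset.mem_union.1 hw).resolve_left h) u hue, hσ.1 u huW]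
  have hN : ((spinsExtending W τ).card : ℝ) = 2 ^ (n - (W.card + (P.d - 1))) * 2 ^ (P.d - 1) := by
    rw [spinsExtending, card_filter_spin_eqOn, ← pow_add]
    push_cast
    congr 1
    omega
  have hcount' : (((spinsExtending W τ).filter
      fun σ => ∀ x ∈ e.1, ∀ y ∈ e.1, σ x = σ y).card : ℝ) ≤
      (spinsExtending W τ).card / 2 ^ (P.d - 1) := by
    rw [hN, mul_div_cancel_right₀ _ (by positivity)]
    exact_mod_cast hcount
  have h1 : ∀ σ, (P.edgeProb n σ e : ℝ) = (P.b + if ∀ x ∈ e.1, ∀ y ∈ e.1, σ x = σ y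
      then P.a - P.b else 0) / n.choose (P.d - 1) := fun σ => by
    rw [P.edgeProb_eq hC]
    split_ifs <;> ring
  simp only [h1]
  rw [← Finset.sum_div, Finset.sum_add_distrib, Finset.sum_const, nsmul_eq_mul,
    ← Finset.sum_filter, Finset.sum_const, nsmul_eq_mul, ← mul_div_assoc, edgeMean_eq]
  gcongr
  have := mul_le_mul_of_nonneg_right hcount' (sub_nonneg.2 P.b_le_a)
  calc _ ≤ _ := add_le_add_right this _
    _ = _ := by ring

/-- The constant in the error terms. -/
noncomputable def errConst (P : HSBMParams) : ℝ := 4 * (P.d - 1 : ℕ) * P.a * (P.a + 1)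

theorem errConst_pos (P : HSBMParams) : 0 < P.errConst := by
  have h1 := P.a_pos
  have h2 : (0 : ℝ) < (P.d - 1 : ℕ) := by exact_mod_cast P.one_le_d_sub_one
  unfold errConst
  positivity

/-- A hyperedge meeting `W` in one vertex meets it in `I`, since it cannot lie inside `W`. There are
at most |I|·C of these, and they give the main term. A hyperedge with two vertices in `W` is one of
at most |W|²·(n choose d-2), each of probability at most a/C, so these contribute only O(|W|²/n). -/
theorem sum_sum_edgeProb_le (P : HSBMParams) (hn : 2 * (P.d - 1) ≤ n)
    (hC : 2 * P.a ≤ n.choose (P.d - 1)) (W I : Finset (Fin n)) (hIW : I ⊆ W) (τ : Fin n → ℤˣ)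
    (F : Finset (P.PotentialEdge n)) (hF : ∀ e ∈ F, (∃ u ∈ I, u ∈ e.1) ∨ e.1 ⊆ W) :
    ∑ σ ∈ spinsExtending W τ, ∑ e ∈ F,
      ((P.edgeProb n σ e : ℝ) + 2 * (P.edgeProb n σ e : ℝ) ^ 2) ≤
      (spinsExtending W τ).card * (P.edgeMean * I.card + P.errConst * W.card ^ 2 / n) := by
  classical
  have ha := P.a_pos
  have hd := P.three_le_d
  have hC' : P.a ≤ n.choose (P.d - 1) := by linarith
  set C := ((n.choose (P.d - 1) : ℕ) : ℝ) with hCdef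
  set N := ((spinsExtending W τ).card : ℝ)
  have hC0 : 0 < C := by linarith
  have hN0 : 0 ≤ N := by positivity
  have hn0 : (0 : ℝ) < n := by
    have : 0 < n := by omega
    exact_mod_cast this
  have hp0 : ∀ σ e, (0 : ℝ) ≤ P.edgeProb n σ e := fun σ e => unitInterval.nonneg _
  have hp : ∀ σ e, (P.edgeProb n σ e : ℝ) ≤ P.a / C := fun σ e => P.edgeProb_le hC' σ e
  have hsq : ∀ σ e, 2 * (P.edgeProb n σ e : ℝ) ^ 2 ≤ 2 * (P.a / C) ^ 2 := fun σ e => by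
    have := hp0 σ e
    have := hp σ e
    gcongr
  have hhalf : P.a / C ≤ 1 / 2 := by rw [div_le_iff₀ hC0]; linarith
  let clean : P.PotentialEdge n → Prop := fun e => ∀ u ∈ W, u ∈ e.1 → ∀ w ∈ W, w ∈ e.1 → w = u
  have hcard1 : ((F.filter clean).card : ℝ) ≤ I.card * C := by
    have : F.filter clean ⊆ I.biUnion fun u =>
        Finset.univ.filter fun e : P.PotentialEdge n => u ∈ e.1 := by
      intro e he
      obtain ⟨heF, hc⟩ := Finset.mem_filter.1 he
      simp only [Finset.mem_biUnion, Finset.mem_filter, Finset.mem_univ, true_and]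
      rcases hF e heF with h | h
      · exact h
      · exfalso
        obtain ⟨x, hx, y, hy, hxy⟩ := Finset.one_lt_card.1 (show 1 < e.1.card by rw [e.2]; omega)
        exact hxy (hc y (h hy) hy x (h hx) hx)
    have h2 := (Finset.card_le_card this).trans
      (Finset.card_biUnion_le_card_mul _ _ _ fun u _ =>
        card_filter_mem_le (d := P.d - 1) (by omega) u)
    rw [hCdef]
    exact_mod_cast h2
  have hcard2 : ((F.filter fun e => ¬ clean e).card : ℝ) ≤
      W.card ^ 2 * n.choose (P.d - 1 - 1) := by
    have : F.filter (fun e => ¬ clean e) ⊆ W.offDiag.biUnion fun t =>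
        Finset.univ.filter fun e : P.PotentialEdge n => t.1 ∈ e.1 ∧ t.2 ∈ e.1 := by
      intro e he
      have hc := (Finset.mem_filter.1 he).2
      simp only [clean, not_forall] at hc
      obtain ⟨u, hu, hue, w, hw, hwe, hne⟩ := hc
      simp only [Finset.mem_biUnion, Finset.mem_filter, Finset.mem_univ, true_and]
      exact ⟨(w, u), Finset.mem_offDiag.2 ⟨hw, hu, hne⟩, hwe, hue⟩
    have h2 := (Finset.card_le_card this).trans
      (Finset.card_biUnion_le_card_mul _ _ _ fun t ht =>
        card_filter_mem_mem_le (d := P.d - 1 - 1) (by omega) (Finset.mem_offDiag.1 ht).2.2)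
    have h3 : W.offDiag.card ≤ W.card ^ 2 := by rw [Finset.offDiag_card, sq]; omega
    exact_mod_cast h2.trans (Nat.mul_le_mul_right _ h3)
  have hf1 : ∀ e ∈ F.filter clean, ∑ σ ∈ spinsExtending W τ,
      ((P.edgeProb n σ e : ℝ) + 2 * (P.edgeProb n σ e : ℝ) ^ 2) ≤
      N * (P.edgeMean / C + 2 * (P.a / C) ^ 2) := by
    intro e he
    obtain ⟨heF, hc⟩ := Finset.mem_filter.1 he
    obtain ⟨u, huW, hue⟩ : ∃ u ∈ W, u ∈ e.1 := by
      rcases hF e heF with ⟨u, hu, h⟩ | h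
      · exact ⟨u, hIW hu, h⟩
      · obtain ⟨x, hx⟩ := Finset.card_pos.1 (show 0 < e.1.card by rw [e.2]; omega)
        exact ⟨x, h hx, hx⟩
    rw [Finset.sum_add_distrib, mul_add]
    refine add_le_add (P.sum_edgeProb_le hC' W τ e huW hue (hc u huW hue)) ?_
    refine (Finset.sum_le_card_nsmul _ _ _ fun σ _ => hsq σ e).trans_eq ?_
    rw [nsmul_eq_mul]
  have hf2 : ∀ e ∈ F.filter (fun e => ¬ clean e), ∑ σ ∈ spinsExtending W τ,
      ((P.edgeProb n σ e : ℝ) + 2 * (P.edgeProb n σ e : ℝ) ^ 2) ≤ N * (2 * P.a / C) := by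
    intro e _
    refine (Finset.sum_le_card_nsmul _ _ (2 * P.a / C) fun σ _ => ?_).trans_eq (nsmul_eq_mul _ _)
    have h0 := hp0 σ e
    have h1 := hp σ e
    have h2 : 2 * P.a / C = 2 * (P.a / C) := by ring
    rw [h2]
    nlinarith
  have hbin : (n : ℝ) * n.choose (P.d - 1 - 1) ≤ 2 * (P.d - 1 : ℕ) * C := by
    rw [hCdef]
    exact_mod_cast mul_choose_le (r := P.d - 1) (by omega) hn
  have hbin1 : (1 : ℝ) ≤ n.choose (P.d - 1 - 1) := by
    exact_mod_cast Nat.choose_pos (by omega)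
  have hIW' : (I.card : ℝ) ≤ W.card ^ 2 := by
    have h1 : I.card ≤ W.card := Finset.card_le_card hIW
    have h2 : W.card ≤ W.card ^ 2 := Nat.le_self_pow two_ne_zero _
    exact_mod_cast h1.trans h2
  have hInvC : 1 / C ≤ 2 * (P.d - 1 : ℕ) / n := by
    rw [div_le_div_iff₀ hC0 hn0]
    nlinarith
  have hratio : (n.choose (P.d - 1 - 1) : ℝ) / C ≤ 2 * (P.d - 1 : ℕ) / n := by
    rw [div_le_div_iff₀ hC0 hn0]
    linarith
  rw [Finset.sum_comm, ← Finset.sum_filter_add_sum_filter_not F clean]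
  have hm := P.edgeMean_pos
  calc _ ≤ (I.card * C) * (N * (P.edgeMean / C + 2 * (P.a / C) ^ 2)) +
        (W.card ^ 2 * n.choose (P.d - 1 - 1)) * (N * (2 * P.a / C)) := by
        refine add_le_add ?_ ?_
        · refine (Finset.sum_le_card_nsmul _ _ _ hf1).trans ?_
          rw [nsmul_eq_mul]
          gcongr
        · refine (Finset.sum_le_card_nsmul _ _ _ hf2).trans ?_
          rw [nsmul_eq_mul]
          gcongr
    _ = N * (P.edgeMean * I.card + (2 * P.a ^ 2 * I.card * (1 / C) +
        2 * P.a * W.card ^ 2 * (n.choose (P.d - 1 - 1) / C))) := by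
        field_simp
        ring
    -- Both 1/C and (n choose d-2)/C are at most 2(d-1)/n, and |I| ≤ |W|². The coefficients 4(d-1)a²
    -- and 4(d-1)a add up to `errConst`.
    _ ≤ N * (P.edgeMean * I.card + (2 * P.a ^ 2 * W.card ^ 2 * (2 * (P.d - 1 : ℕ) / n) +
        2 * P.a * W.card ^ 2 * (2 * (P.d - 1 : ℕ) / n))) := by
        gcongr
    _ = _ := by
        rw [errConst]
        ring

end HSBMParams

/-! ### Probability that a fixed labelling embeds the tree -/

namespace HSBMParams

variable {P : HSBMParams} {n l : ℕ} {s : ℤˣ} {i : Fin n} {ω : P.Growth} {φ : P.Address → Fin n}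

/-- The set of labels of a hyperedge of the hypertree. -/
def edgeImage (P : HSBMParams) (φ : P.Address → Fin n) (t : (_ : P.Address) × ℕ) :
    Finset (Fin n) :=
  insert (φ t.1) (Finset.univ.image fun j => φ ((t.2, j) :: t.1))

theorem coe_edgeImage (φ : P.Address → Fin n) (t : (_ : P.Address) × ℕ) :
    (P.edgeImage φ t : Set (Fin n)) = φ '' P.treeEdge t.1 t.2 := by
  rw [edgeImage, treeEdge, Set.image_insert_eq, ← Set.range_comp]
  simp
  rfl

theorem card_edgeImage (hφ : Set.InjOn φ (P.nodes l ω)) {t : (_ : P.Address) × ℕ}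
    (ht : t ∈ P.edgeFin l ω) : (P.edgeImage φ t).card = P.d := by
  have ht' := mem_edgeFin.1 ht
  have hsub := treeEdge_subset_nodes ht'.1 ht'.2
  have hv : t.1 ∈ P.nodes l ω := hsub (mem_treeEdge.2 (Or.inl rfl))
  have hc : ∀ j, (t.2, j) :: t.1 ∈ P.nodes l ω := fun j => hsub (mem_treeEdge.2 (Or.inr ⟨j, rfl⟩))
  rw [edgeImage, Finset.card_insert_of_notMem, Finset.card_image_of_injective,
    Finset.card_univ, Fintype.card_fin]
  · have := P.three_le_d; omega
  · intro j j' h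
    simpa using hφ (hc j) (hc j') h
  · intro h
    obtain ⟨j, -, hj⟩ := Finset.mem_image.1 h
    exact absurd (congrArg List.length (hφ (hc j) hv hj)) (by simp)

/-- The potential hyperedges which are labelled hyperedges of the truncated hypertree. -/
noncomputable def treeSet (P : HSBMParams) (l : ℕ) (ω : P.Growth) (φ : P.Address → Fin n) :
    Finset (P.PotentialEdge n) :=
  open scoped Classical in
  Finset.univ.filter fun e => ∃ t ∈ P.edgeFin l ω, e.1 = P.edgeImage φ t

/-- The potential hyperedges whose absence is required for `φ` to embed the truncated hypertree as
a neighbourhood. -/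
noncomputable def avoidSet (P : HSBMParams) (l : ℕ) (ω : P.Growth) (φ : P.Address → Fin n) :
    Finset (P.PotentialEdge n) :=
  open scoped Classical in
  Finset.univ.filter fun e => e ∉ P.treeSet l ω φ ∧
    ((∃ u ∈ (P.internalFin l ω).image φ, u ∈ e.1) ∨ e.1 ⊆ (P.nodeFin l ω).image φ)

theorem mem_treeSet {e : P.PotentialEdge n} :
    e ∈ P.treeSet l ω φ ↔ ∃ t ∈ P.edgeFin l ω, e.1 = P.edgeImage φ t := by
  simp [treeSet]

theorem mem_avoidSet {e : P.PotentialEdge n} :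
    e ∈ P.avoidSet l ω φ ↔ e ∉ P.treeSet l ω φ ∧
      ((∃ u ∈ (P.internalFin l ω).image φ, u ∈ e.1) ∨ e.1 ⊆ (P.nodeFin l ω).image φ) := by
  simp [avoidSet]

theorem embeds_of_treeSet_avoidSet (hφ : Set.InjOn φ (P.nodes l ω)) (hroot : φ [] = i)
    {x : P.Sample n} (hσ : ∀ v ∈ P.nodes l ω, x.2 (φ v) = P.treeSpin s ω v)
    (htree : ∀ e ∈ P.treeSet l ω φ, x.1 e = true)
    (havoid : ∀ e ∈ P.avoidSet l ω φ, x.1 e = false) : P.Embeds l s i ω φ x := by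
  refine ⟨hroot, hφ, hσ, fun v hv k hk => ?_, ?_⟩
  · have ht : (⟨v, k⟩ : (_ : P.Address) × ℕ) ∈ P.edgeFin l ω := mem_edgeFin.2 ⟨hv, hk⟩
    exact ⟨⟨P.edgeImage φ ⟨v, k⟩, card_edgeImage hφ ht⟩, htree _ (mem_treeSet.2 ⟨_, ht, rfl⟩),
      (coe_edgeImage φ ⟨v, k⟩).symm⟩
  · rintro _ ⟨e, he, rfl⟩ hc
    have hmem : e ∈ P.treeSet l ω φ := by
      by_contra hnot
      have : e ∈ P.avoidSet l ω φ := by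
        refine mem_avoidSet.2 ⟨hnot, ?_⟩
        rcases hc with ⟨v, hv, hve⟩ | h
        · exact Or.inl ⟨φ v, Finset.mem_image_of_mem _ (mem_internalFin.2 hv), hve⟩
        · right
          intro u hu
          obtain ⟨v, hv, rfl⟩ := h hu
          exact Finset.mem_image_of_mem _ (mem_nodeFin.2 hv)
      rw [havoid e this] at he
      exact absurd he (by simp)
    obtain ⟨t, ht, he⟩ := mem_treeSet.1 hmem
    have ht' := mem_edgeFin.1 ht
    exact ⟨t.1, ht'.1, t.2, ht'.2, by rw [he, coe_edgeImage]⟩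

/-- Distinct tree hyperedges have distinct images, and the spins on an image are constant exactly
when all children agree with their parent. -/
theorem prod_treeSet (hφ : Set.InjOn φ (P.nodes l ω)) (hC : P.a ≤ n.choose (P.d - 1))
    {σ : Fin n → ℤˣ} (hσ : ∀ v ∈ P.nodes l ω, σ (φ v) = P.treeSpin s ω v) :
    ∏ e ∈ P.treeSet l ω φ, (P.edgeProb n σ e : ℝ) =
      ∏ t ∈ P.edgeFin l ω, P.edgeWeight ((ω t.1).2 t.2) / n.choose (P.d - 1) := by
  classical
  symm
  refine Finset.prod_bij (fun t ht => ⟨P.edgeImage φ t, card_edgeImage hφ ht⟩) ?_ ?_ ?_ ?_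
  · exact fun t ht => mem_treeSet.2 ⟨t, ht, rfl⟩
  · rintro ⟨v, k⟩ ht ⟨v', k'⟩ ht' h
    have h' := congrArg (fun e : P.PotentialEdge n => (e.1 : Set (Fin n))) h
    simp only [coe_edgeImage] at h'
    have h1 := mem_edgeFin.1 ht
    have h2 := mem_edgeFin.1 ht'
    obtain ⟨rfl, rfl⟩ := treeEdge_injective ((hφ.image_eq_image_iff
      (treeEdge_subset_nodes h1.1 h1.2) (treeEdge_subset_nodes h2.1 h2.2)).1 h')
    rfl
  · intro e he
    obtain ⟨t, ht, h⟩ := mem_treeSet.1 he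
    exact ⟨t, ht, Subtype.ext h.symm⟩
  · rintro ⟨v, k⟩ ht
    have h1 := mem_edgeFin.1 ht
    have hsub := treeEdge_subset_nodes h1.1 h1.2
    rw [P.edgeProb_eq hC]
    congr 1
    have hs1 : σ (φ v) = P.treeSpin s ω v := hσ _ (hsub (mem_treeEdge.2 (Or.inl rfl)))
    have hs2 : ∀ j, σ (φ ((k, j) :: v)) =
        if j ∈ (ω v).2 k then P.treeSpin s ω v else -P.treeSpin s ω v := fun j =>
      hσ _ (hsub (mem_treeEdge.2 (Or.inr ⟨j, rfl⟩)))
    have hne : -P.treeSpin s ω v ≠ P.treeSpin s ω v := by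
      intro h0
      rcases Int.units_eq_one_or (P.treeSpin s ω v) with h1 | h1 <;> rw [h1] at h0 <;>
        exact absurd h0 (by decide)
    have hiff : (∀ x ∈ P.edgeImage φ ⟨v, k⟩, ∀ y ∈ P.edgeImage φ ⟨v, k⟩, σ x = σ y) ↔
        (ω v).2 k = Finset.univ := by
      have h0 : φ v ∈ P.edgeImage φ ⟨v, k⟩ := Finset.mem_insert_self _ _
      constructor
      · intro h
        rw [Finset.eq_univ_iff_forall]
        intro j
        by_contra hj
        have := h (φ ((k, j) :: v))
          (Finset.mem_insert_of_mem (Finset.mem_image_of_mem _ (Finset.mem_univ j))) _ h0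
        rw [hs2, if_neg hj, hs1] at this
        exact hne this
      · intro h
        have hall : ∀ x ∈ P.edgeImage φ ⟨v, k⟩, σ x = P.treeSpin s ω v := by
          intro x hx
          rcases Finset.mem_insert.1 hx with rfl | hx
          · exact hs1
          · obtain ⟨j, -, rfl⟩ := Finset.mem_image.1 hx
            rw [hs2, if_pos (by rw [h]; exact Finset.mem_univ j)]
        intro x hx y hy
        rw [hall x hx, hall y hy]
    simp only [edgeWeight, hiff]

theorem disjoint_treeSet_avoidSet (P : HSBMParams) (l : ℕ) (ω : P.Growth)
    (φ : P.Address → Fin n) : Disjoint (P.treeSet l ω φ) (P.avoidSet l ω φ) :=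
  Finset.disjoint_left.2 fun _ h h' => (mem_avoidSet.1 h').1 h

/-- A lower bound for the probability that given labels embed the truncated hypertree. -/
theorem le_condLaw_embeds (s : ℤˣ) (hφ : Set.InjOn φ (P.nodes l ω)) (hroot : φ [] = i)
    (hn : 2 * (P.d - 1) ≤ n) (hC : 2 * P.a ≤ n.choose (P.d - 1)) :
    ENNReal.ofReal ((∏ t ∈ P.edgeFin l ω,
      P.edgeWeight ((ω t.1).2 t.2) / (2 ^ (P.d - 1) * n.choose (P.d - 1))) *
      Real.exp (-(P.edgeMean * (P.internalFin l ω).card +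
        P.errConst * (P.nodeFin l ω).card ^ 2 / n))) ≤
      P.condLaw i s {x | P.Embeds l s i ω φ x} := by
  classical
  have hC' : P.a ≤ n.choose (P.d - 1) := by have := P.a_pos; linarith
  have hspin : ∀ x ∈ {x : P.Sample n | P.Embeds l s i ω φ x}, x.2 i = s := by
    intro x hx
    have := Embeds.spin hx [] (P.nil_mem_nodes l ω)
    rwa [hroot] at this
  rw [condLaw_apply P i s _ hspin]
  obtain ⟨τ, hτ⟩ : ∃ τ : Fin n → ℤˣ, ∀ v ∈ P.nodes l ω, τ (φ v) = P.treeSpin s ω v := by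
    refine ⟨fun u => P.treeSpin s ω (Function.invFunOn φ (P.nodes l ω) u), fun v hv => ?_⟩
    simp only [hφ.leftInvOn_invFunOn hv]
  set W := (P.nodeFin l ω).image φ with hW
  set I := (P.internalFin l ω).image φ with hI
  have hφ' : Set.InjOn φ (P.nodeFin l ω : Set P.Address) := fun v hv w hw h =>
    hφ (mem_nodeFin.1 hv) (mem_nodeFin.1 hw) h
  have hIsub := P.internalFin_subset_nodeFin l ω
  have hWcard : W.card = (P.nodeFin l ω).card := Finset.card_image_of_injOn hφ'
  have hIcard : I.card = (P.internalFin l ω).card :=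
    Finset.card_image_of_injOn (hφ'.mono (by exact_mod_cast hIsub))
  have hext : ∀ σ ∈ spinsExtending W τ, ∀ v ∈ P.nodes l ω, σ (φ v) = P.treeSpin s ω v := by
    intro σ hσ v hv
    simp only [spinsExtending, Finset.mem_filter, Finset.mem_univ, true_and] at hσ
    rw [hσ _ (Finset.mem_image_of_mem _ (mem_nodeFin.2 hv)), hτ v hv]
  have hZ := P.sum_sum_edgeProb_le hn hC W I (Finset.image_subset_image hIsub) τ
    (P.avoidSet l ω φ) fun e he => (mem_avoidSet.1 he).2
  have hp1 : ∀ σ e, (P.edgeProb n σ e : ℝ) ≤ 1 / 2 := by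
    intro σ e
    refine (P.edgeProb_le hC' σ e).trans ?_
    have : (0 : ℝ) < n.choose (P.d - 1) := P.a_pos.trans_le hC'
    rw [div_le_iff₀ this]; linarith
  -- The forbidden hyperedges are independent only given the spins. Jensen's inequality replaces the
  -- exponent by its average over the free spins.
  have hJ := mul_exp_le_sum_prod_one_sub (spinsExtending W τ) (P.avoidSet l ω φ)
    (fun σ e => (P.edgeProb n σ e : ℝ)) (fun σ _ e _ => unitInterval.nonneg _)
    (fun σ _ e _ => hp1 σ e) hZ
  have hprod0 : 0 ≤ ∏ t ∈ P.edgeFin l ω, P.edgeWeight ((ω t.1).2 t.2) / n.choose (P.d - 1) :=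
    Finset.prod_nonneg fun t _ => div_nonneg (P.edgeWeight_pos _).le (by positivity)
  have hterm : ∀ σ ∈ spinsExtending W τ,
      ENNReal.ofReal (2 * (1 / 2) ^ n * ((∏ t ∈ P.edgeFin l ω,
        P.edgeWeight ((ω t.1).2 t.2) / n.choose (P.d - 1)) *
        ∏ e ∈ P.avoidSet l ω φ, (1 - (P.edgeProb n σ e : ℝ)))) ≤
      ENNReal.ofReal (2 * (1 / 2) ^ n) *
        P.edgeLaw n σ {T | (T, σ) ∈ {x : P.Sample n | P.Embeds l s i ω φ x}} := by
    intro σ hσ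
    rw [ENNReal.ofReal_mul (by positivity), ← prod_treeSet hφ hC' (hext σ hσ),
      ← P.edgeLaw_pi σ _ _ (P.disjoint_treeSet_avoidSet l ω φ)]
    exact mul_le_mul_right (measure_mono fun T hT =>
      embeds_of_treeSet_avoidSet hφ hroot (hext σ hσ) hT.1 hT.2) _
  calc _ ≤ ENNReal.ofReal (∑ σ ∈ spinsExtending W τ, 2 * (1 / 2) ^ n * ((∏ t ∈ P.edgeFin l ω,
        P.edgeWeight ((ω t.1).2 t.2) / n.choose (P.d - 1)) *
        ∏ e ∈ P.avoidSet l ω φ, (1 - (P.edgeProb n σ e : ℝ)))) := by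
        apply ENNReal.ofReal_le_ofReal
        rw [← Finset.mul_sum, ← Finset.mul_sum]
        refine le_trans (le_of_eq ?_) (mul_le_mul_of_nonneg_left
          (mul_le_mul_of_nonneg_left hJ hprod0) (by positivity))
        rw [hIcard, hWcard, spinsExtending, card_filter_spin_eqOn, hWcard]
        have hsplit : ∀ t ∈ P.edgeFin l ω,
            P.edgeWeight ((ω t.1).2 t.2) / (2 ^ (P.d - 1) * n.choose (P.d - 1)) =
            (1 / 2) ^ (P.d - 1) * (P.edgeWeight ((ω t.1).2 t.2) / n.choose (P.d - 1)) :=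
          fun t _ => by
            rw [one_div_pow]
            field_simp
        rw [Finset.prod_congr rfl hsplit, Finset.prod_mul_distrib, Finset.prod_const, ← pow_mul]
        have hVn : (P.nodeFin l ω).card ≤ n := by
          rw [← hWcard]; exact (Finset.card_le_univ _).trans_eq (Fintype.card_fin n)
        have hV := P.card_nodeFin l ω
        -- The factor 2 comes from conditioning on the root spin. The other V - 1 prescribed spins
        -- contribute 2^{-(d-1)} per tree hyperedge.
        have hpow : (2 : ℝ) * (1 / 2) ^ n * 2 ^ (n - (P.nodeFin l ω).card) =
            (1 / 2) ^ ((P.d - 1) * (P.edgeFin l ω).card) := by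
          obtain ⟨m, hm⟩ := Nat.exists_eq_add_of_le hVn
          have h1 : n - (P.nodeFin l ω).card = m := by omega
          rw [h1]
          conv_lhs => rw [hm, hV]
          rw [pow_add, pow_add, pow_one]
          have : (1 / 2 : ℝ) ^ m * 2 ^ m = 1 := by rw [← mul_pow]; norm_num
          linear_combination (1 / 2 : ℝ) ^ ((P.d - 1) * (P.edgeFin l ω).card) * this
        rw [← hpow]
        push_cast
        ring
    _ = ∑ σ ∈ spinsExtending W τ, ENNReal.ofReal (2 * (1 / 2) ^ n * ((∏ t ∈ P.edgeFin l ω,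
        P.edgeWeight ((ω t.1).2 t.2) / n.choose (P.d - 1)) *
        ∏ e ∈ P.avoidSet l ω φ, (1 - (P.edgeProb n σ e : ℝ)))) := by
        refine ENNReal.ofReal_sum_of_nonneg fun σ _ => ?_
        refine mul_nonneg (by positivity) (mul_nonneg hprod0 (Finset.prod_nonneg fun e _ => ?_))
        exact sub_nonneg.2 (unitInterval.le_one _)
    _ ≤ ∑ σ ∈ spinsExtending W τ, ENNReal.ofReal (2 * (1 / 2) ^ n) *
        P.edgeLaw n σ {T | (T, σ) ∈ {x : P.Sample n | P.Embeds l s i ω φ x}} :=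
        Finset.sum_le_sum hterm
    _ ≤ _ := Finset.sum_le_sum_of_subset (Finset.subset_univ _)

end HSBMParams

/-! ### Comparison of class probabilities and the coupling at fixed depth -/

namespace HSBMParams

variable {P : HSBMParams} {n l : ℕ} {s : ℤˣ} {i : Fin n} {ω : P.Growth}

/-- The spin hypergraphs whose neighbourhood of `i` is a copy of the truncated hypertree with
increasing labels. -/
def labelEvent (P : HSBMParams) (l : ℕ) (s : ℤˣ) (i : Fin n) (ω : P.Growth) : Set (P.Sample n) :=
  {x | ∃ φ : P.Address → Fin n, P.Embeds l s i ω φ x ∧ P.SortedLabels l ω φ}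

theorem labelEvent_eq {ω' : P.Growth} (h : ω' ∈ P.growthClass l ω) :
    P.labelEvent l s i ω' = P.labelEvent l s i ω := by
  ext x
  exact ⟨fun ⟨φ, h1, h2⟩ => ⟨φ, h1.of_mem_growthClass (mem_growthClass_symm h),
      h2.of_mem_growthClass (mem_growthClass_symm h)⟩,
    fun ⟨φ, h1, h2⟩ => ⟨φ, h1.of_mem_growthClass h, h2.of_mem_growthClass h⟩⟩

/-- Distinct sorted labellings give disjoint embedding events by `Embeds.unique`, so their
probabilities add up. -/
theorem nsmul_le_condLaw_labelEvent (s : ℤˣ) (i : Fin n) (ω : P.Growth)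
    (hn : 2 * (P.d - 1) ≤ n) (hC : 2 * P.a ≤ n.choose (P.d - 1)) :
    (P.sortedLabelings l ω i).card • ENNReal.ofReal ((∏ t ∈ P.edgeFin l ω,
      P.edgeWeight ((ω t.1).2 t.2) / (2 ^ (P.d - 1) * n.choose (P.d - 1))) *
      Real.exp (-(P.edgeMean * (P.internalFin l ω).card +
        P.errConst * (P.nodeFin l ω).card ^ 2 / n))) ≤ P.condLaw i s (P.labelEvent l s i ω) := by
  have hdisj : (P.sortedLabelings l ω i : Set (P.nodeFin l ω → Fin n)).PairwiseDisjoint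
      fun ψ => {x : P.Sample n | P.Embeds l s i ω (labelExt i ψ) x} := by
    intro ψ hψ ψ' hψ' hne
    refine Set.disjoint_left.2 fun x hx hx' => hne ?_
    have := (Embeds.unique hx hx' (mem_sortedLabelings.1 hψ).2 (mem_sortedLabelings.1 hψ').2).2
    ext w
    rw [← labelExt_coe i ψ w, ← labelExt_coe i ψ' w, this (mem_nodeFin.1 w.2)]
  have hsub : (⋃ ψ ∈ P.sortedLabelings l ω i,
      {x : P.Sample n | P.Embeds l s i ω (labelExt i ψ) x}) ⊆ P.labelEvent l s i ω := by
    intro x hx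
    simp only [Set.mem_iUnion] at hx
    obtain ⟨ψ, hψ, hx⟩ := hx
    exact ⟨_, hx, (mem_sortedLabelings.1 hψ).2⟩
  refine le_trans ?_ (measure_mono hsub)
  rw [measure_biUnion_finset hdisj fun _ _ => (Set.toFinite _).measurableSet]
  refine Finset.card_nsmul_le_sum _ _ _ fun ψ hψ => ?_
  have h := (mem_sortedLabelings.1 hψ).1
  refine le_condLaw_embeds s (fun v hv w hw hvw => ?_) ?_ hn hC
  · have h1 := labelExt_coe i ψ ⟨v, mem_nodeFin.2 hv⟩
    have h2 := labelExt_coe i ψ ⟨w, mem_nodeFin.2 hw⟩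
    simp only at h1 h2
    rw [h1, h2] at hvw
    exact congrArg Subtype.val (h.1 hvw)
  · exact (labelExt_coe i ψ (P.rootNode l ω)).trans h.2

/-- The probability that the neighbourhood of `i` is a copy of a given truncated hypertree is at
least its probability under the growth process, up to a relative error. -/
theorem growthLaw_growthClass_le (s : ℤˣ) (i : Fin n) (ω : P.Growth)
    (hn : 2 * (P.d - 1) ≤ n) (hC : 2 * P.a ≤ n.choose (P.d - 1)) :
    P.growthLaw (P.growthClass l ω) ≤ P.condLaw i s (P.labelEvent l s i ω) +
      ENNReal.ofReal ((P.errConst + 1) * (P.nodeFin l ω).card ^ 2 / n) *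
        P.growthLaw (P.growthClass l ω) := by
  have hn0 : (0 : ℝ) < n := by exact_mod_cast i.pos
  have hK := P.errConst_pos
  have hCpos : (0 : ℝ) < n.choose (P.d - 1) := by have := P.a_pos; linarith
  have hV := P.card_nodeFin l ω
  set V := (P.nodeFin l ω).card with hVdef
  set E := (P.edgeFin l ω).card with hE
  -- A tree with more than n vertices has no injective labelling, but then the relative error
  -- exceeds 1 and the bound is trivial.
  rcases lt_or_ge n V with hnV | hVn
  · have h1 : (1 : ℝ) ≤ (P.errConst + 1) * V ^ 2 / n := by
      rw [le_div_iff₀ hn0]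
      have h2 : (n : ℝ) ≤ V := by exact_mod_cast hnV.le
      have h3 : (1 : ℝ) ≤ n := by exact_mod_cast i.pos
      nlinarith [mul_nonneg hK.le (sq_nonneg (V : ℝ))]
    calc _ = 1 * P.growthLaw (P.growthClass l ω) := (one_mul _).symm
      _ ≤ ENNReal.ofReal ((P.errConst + 1) * V ^ 2 / n) * P.growthLaw (P.growthClass l ω) := by
          gcongr; exact ENNReal.one_le_ofReal.2 h1
      _ ≤ _ := le_add_self
  set Q : ℝ := ∏ t ∈ P.edgeFin l ω, P.edgeWeight ((ω t.1).2 t.2) / 2 ^ (P.d - 1) with hQ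
  set D : ℝ := ∏ v ∈ P.internalFin l ω, ((ω v).1.factorial : ℝ) with hD
  set Λ : ℝ := Real.exp (-(P.edgeMean * (P.internalFin l ω).card)) with hΛ
  have hQ0 : 0 ≤ Q := Finset.prod_nonneg fun t _ => div_nonneg (P.edgeWeight_pos _).le (by positivity)
  have hD0 : 0 < D := Finset.prod_pos fun v _ => by exact_mod_cast Nat.factorial_pos _
  have hΛ0 : 0 < Λ := Real.exp_pos _
  have hν : P.growthLaw (P.growthClass l ω) = ENNReal.ofReal (Λ / D * Q) := by
    rw [growthLaw_growthClass]
    congr 1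
    rw [Finset.prod_mul_distrib, Finset.prod_div_distrib, Finset.prod_const, ← Real.exp_nat_mul,
      hQ, edgeFin, Finset.prod_sigma, hΛ]
    congr 4
    ring
  have hsorted : ((n + 1 - V : ℕ) : ℝ) ^ ((P.d - 1) * E) ≤
      (P.sortedLabelings l ω i).card * (D * ((P.d - 1).factorial : ℝ) ^ E) := by
    have h1 := (P.pow_le_card_rootedLabelings l ω i).trans (P.card_rootedLabelings_le l ω i)
    rw [Finset.prod_mul_distrib, Finset.prod_pow_eq_pow_sum] at h1
    have h2 : ∑ v ∈ P.internalFin l ω, (ω v).1 = E := by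
      rw [hE, edgeFin, Finset.card_sigma]
      simp
    rw [h2] at h1
    rw [hD]
    exact_mod_cast h1
  have hfact : ((P.d - 1).factorial : ℝ) * n.choose (P.d - 1) ≤ (n : ℝ) ^ (P.d - 1) := by
    have h1 := Nat.descFactorial_eq_factorial_mul_choose n (P.d - 1)
    have h2 := Nat.descFactorial_le_pow n (P.d - 1)
    rw [h1] at h2
    exact_mod_cast h2
  set x : ℝ := (V : ℝ) ^ 2 / n with hx
  have hx0 : 0 ≤ x := by positivity
  -- Bernoulli's inequality with exponent V - 1 and base 1 - (V-1)/n.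
  have hbern : 1 - x ≤ (((n + 1 - V : ℕ) : ℝ) / n) ^ ((P.d - 1) * E) := by
    have hVn' : (V : ℝ) ≤ n := by exact_mod_cast hVn
    have hV1 : (1 : ℝ) ≤ V := by rw [hV]; push_cast; nlinarith [Nat.zero_le ((P.d - 1) * E)]
    have hm : (((P.d - 1) * E : ℕ) : ℝ) = V - 1 := by rw [hV]; push_cast; ring
    have hcast : ((n + 1 - V : ℕ) : ℝ) / n = 1 + -((V - 1) / n) := by
      rw [Nat.cast_sub (by omega)]
      push_cast
      field_simp
      ring
    have hle : (V - 1 : ℝ) / n ≤ 1 := by rw [div_le_one hn0]; linarith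
    rw [hcast]
    refine le_trans ?_ (one_add_mul_le_pow (by linarith) _)
    rw [hm, hx]
    have : (V - 1 : ℝ) * ((V - 1) / n) ≤ (V : ℝ) ^ 2 / n := by
      rw [← mul_div_assoc]
      gcongr
      nlinarith
    linarith
  have hcount : (1 - x) / D ≤
      (P.sortedLabelings l ω i).card * (1 / (n.choose (P.d - 1) : ℝ) ^ E) := by
    rw [div_le_iff₀ hD0]
    refine hbern.trans ?_
    rw [div_pow, div_le_iff₀ (by positivity)]
    refine hsorted.trans ?_
    have h1 : ((P.d - 1).factorial : ℝ) ^ E * (n.choose (P.d - 1) : ℝ) ^ E ≤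
        (n : ℝ) ^ ((P.d - 1) * E) := by
      rw [← mul_pow, pow_mul]
      gcongr
    have h2 : ((P.d - 1).factorial : ℝ) ^ E ≤
        1 / (n.choose (P.d - 1) : ℝ) ^ E * (n : ℝ) ^ ((P.d - 1) * E) := by
      rw [one_div, inv_mul_eq_div, le_div_iff₀ (by positivity)]
      exact h1
    calc _ ≤ (P.sortedLabelings l ω i).card *
          (D * (1 / (n.choose (P.d - 1) : ℝ) ^ E * (n : ℝ) ^ ((P.d - 1) * E))) := by gcongr
      _ = _ := by ring
  have hμ := nsmul_le_condLaw_labelEvent (l := l) s i ω hn hC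
  rw [nsmul_eq_mul, ← ENNReal.ofReal_natCast, ← ENNReal.ofReal_mul (by positivity)] at hμ
  refine le_trans ?_ (add_le_add_left hμ _)
  rw [hν, ← ENNReal.ofReal_mul (by positivity), ← ENNReal.ofReal_add]
  rotate_left
  · exact mul_nonneg (by positivity) (mul_nonneg (Finset.prod_nonneg fun t _ =>
      div_nonneg (P.edgeWeight_pos _).le (by positivity)) (Real.exp_pos _).le)
  · positivity
  apply ENNReal.ofReal_le_ofReal
  have hsplit : ∏ t ∈ P.edgeFin l ω,
      P.edgeWeight ((ω t.1).2 t.2) / (2 ^ (P.d - 1) * n.choose (P.d - 1)) =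
      Q * (1 / (n.choose (P.d - 1) : ℝ) ^ E) := by
    rw [hQ, hE, ← one_div_pow, ← Finset.prod_const, ← Finset.prod_mul_distrib]
    refine Finset.prod_congr rfl fun t _ => ?_
    field_simp
  have hexp : Real.exp (-(P.edgeMean * (P.internalFin l ω).card + P.errConst * V ^ 2 / n)) =
      Λ * Real.exp (-(P.errConst * x)) := by
    rw [hΛ, ← Real.exp_add, hx]
    congr 1
    ring
  rw [hsplit, hexp]
  set X : ℝ := Real.exp (-(P.errConst * x)) with hX
  have hX0 : 0 < X := Real.exp_pos _
  have hX1 : 1 - P.errConst * x ≤ X := by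
    have := Real.add_one_le_exp (-(P.errConst * x))
    linarith
  have hXle : X ≤ 1 := Real.exp_le_one_iff.2 (by nlinarith)
  have herr : (P.errConst + 1) * (V : ℝ) ^ 2 / n = (P.errConst + 1) * x := by rw [hx]; ring
  rw [herr]
  -- Writing the product as X - xX and using X ≤ 1 avoids any assumption on the sign of 1 - x.
  have hkey : 1 - (P.errConst + 1) * x ≤ (1 - x) * X := by nlinarith
  have h1 : Q * Λ * X * ((1 - x) / D) ≤ Q * Λ * X * ((P.sortedLabelings l ω i).card *
      (1 / (n.choose (P.d - 1) : ℝ) ^ E)) := mul_le_mul_of_nonneg_left hcount (by positivity)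
  have h2 : Λ / D * Q * (1 - (P.errConst + 1) * x) ≤ Λ / D * Q * ((1 - x) * X) :=
    mul_le_mul_of_nonneg_left hkey (by positivity)
  calc Λ / D * Q = Λ / D * Q * (1 - (P.errConst + 1) * x) +
        (P.errConst + 1) * x * (Λ / D * Q) := by ring
    _ ≤ Λ / D * Q * ((1 - x) * X) + (P.errConst + 1) * x * (Λ / D * Q) := by gcongr
    _ = Q * Λ * X * ((1 - x) / D) + (P.errConst + 1) * x * (Λ / D * Q) := by ring
    _ ≤ Q * Λ * X * ((P.sortedLabelings l ω i).card *
          (1 / (n.choose (P.d - 1) : ℝ) ^ E)) + (P.errConst + 1) * x * (Λ / D * Q) := by gcongr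
    _ = _ := by ring

theorem growthLaw_growthClass_ne_zero (P : HSBMParams) (l : ℕ) (ω : P.Growth) :
    P.growthLaw (P.growthClass l ω) ≠ 0 := by
  rw [growthLaw_growthClass, Ne, ENNReal.ofReal_eq_zero, not_le]
  refine Finset.prod_pos fun v _ => mul_pos (by positivity) (Finset.prod_pos fun k _ => ?_)
  have := P.edgeWeight_pos ((ω v).2 k)
  positivity

/-- A coupling of the neighbourhood of `i` with the hypertree, for a given depth `l` and a cutoff
`M` for the size of the hypertree. -/
theorem exists_isCoupling (P : HSBMParams) {n : ℕ} (l : ℕ) (i : Fin n) (s : ℤˣ)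
    (hn : 2 * (P.d - 1) ≤ n) (hC : 2 * P.a ≤ n.choose (P.d - 1)) {M : ℝ} (hM : 0 < M) :
    ∃ π : Measure (P.Sample n × P.Growth), IsCoupling π (P.condLaw i s) P.growthLaw ∧
      ∃ G : Set (P.Sample n × P.Growth), MeasurableSet G ∧
        (∀ z ∈ G, SpinIso ((P.sampleGraph z.1 i).truncate l)
          ((P.treeGraph s z.2).truncate l)) ∧
        1 - (1 / M + (P.errConst + 1) * M / n) * ((l + 1) * max 1 P.alpha ^ l) ≤ π.real G := by
  have hn0 : (0 : ℝ) < n := by exact_mod_cast i.pos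
  have hK := P.errConst_pos
  set κ : ℝ := 1 / M + (P.errConst + 1) * M / n with hκ
  have hκ0 : 0 ≤ κ := by positivity
  have he : ∀ ω, P.growthLaw (P.growthClass l ω) ≤ P.condLaw i s (P.labelEvent l s i ω) +
      (ENNReal.ofReal κ * (P.nodeFin l ω).card) * P.growthLaw (P.growthClass l ω) := by
    intro ω
    set V := (P.nodeFin l ω).card
    rw [← ENNReal.ofReal_natCast, ← ENNReal.ofReal_mul hκ0]
    -- The quadratic error is made linear in V: below the cutoff V² ≤ MV, and above it V/M ≥ 1
    -- covers everything. Only a first moment remains.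
    rcases le_total (V : ℝ) M with h | h
    · refine (growthLaw_growthClass_le s i ω hn hC).trans ?_
      gcongr
      have h1 : (P.errConst + 1) * (V : ℝ) ^ 2 / n ≤ (P.errConst + 1) * M / n * V := by
        rw [div_mul_eq_mul_div, sq, mul_assoc (P.errConst + 1) M]
        gcongr
      refine h1.trans ?_
      gcongr
      rw [hκ]
      have : 0 < 1 / M := by positivity
      linarith
    · have h1 : 1 ≤ κ * V := by
        calc (1 : ℝ) = 1 / M * M := by field_simp
          _ ≤ κ * V := by
            gcongr
            rw [hκ]
            have : 0 ≤ (P.errConst + 1) * M / n := by positivity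
            linarith
      calc _ = 1 * P.growthLaw (P.growthClass l ω) := (one_mul _).symm
        _ ≤ ENNReal.ofReal (κ * V) * P.growthLaw (P.growthClass l ω) := by
            gcongr; exact ENNReal.one_le_ofReal.2 h1
        _ ≤ _ := le_add_self
  obtain ⟨π, hπ, G, hG, hiso, hmass⟩ := exists_isCoupling_of_classes (P.condLaw i s) P.growthLaw
    (P.growthClass l) (P.labelEvent l s i) (P.measurableSet_growthClass l)
    (P.growthLaw_growthClass_ne_zero l) (fun ω ω' h => ⟨growthClass_eq h, labelEvent_eq h⟩)
    (fun x ω ω' ⟨φ, h1, h2⟩ ⟨φ', h1', h2'⟩ => (h1.unique h1' h2 h2').1) _ he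
  refine ⟨π, hπ, G, hG, fun z hz => ?_, ?_⟩
  · obtain ⟨φ, hφ, -⟩ := hiso z hz
    exact hφ.spinIso
  · have hπp : IsProbabilityMeasure π := by
      refine ⟨?_⟩
      rw [← Set.preimage_univ (f := Prod.fst), ← Measure.map_apply measurable_fst .univ, hπ.1]
      exact measure_univ
    have hα := P.alpha_pos
    have hint : ∫⁻ ω, ENNReal.ofReal κ * (P.nodeFin l ω).card ∂P.growthLaw ≤
        ENNReal.ofReal (κ * ((l + 1) * max 1 P.alpha ^ l)) := by
      rw [lintegral_const_mul' _ _ ENNReal.ofReal_ne_top, lintegral_card_nodeFin,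
        ENNReal.ofReal_mul hκ0]
      gcongr
      simp only [← ENNReal.ofReal_pow hα.le]
      rw [← ENNReal.ofReal_sum_of_nonneg fun _ _ => by positivity]
      apply ENNReal.ofReal_le_ofReal
      refine (Finset.sum_le_card_nsmul _ _ (max 1 P.alpha ^ l) fun m hm => ?_).trans_eq ?_
      · calc P.alpha ^ m ≤ max 1 P.alpha ^ m := by gcongr; exact le_max_right _ _
          _ ≤ max 1 P.alpha ^ l :=
            pow_le_pow_right₀ (le_max_left _ _) (Nat.lt_succ_iff.1 (Finset.mem_range.1 hm))
      · rw [Finset.card_range, nsmul_eq_mul]; push_cast; ring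
    have h1 := hmass.trans (add_le_add_right hint _)
    rw [← ofReal_measureReal, ← ENNReal.ofReal_add measureReal_nonneg (by positivity),
      ENNReal.one_le_ofReal] at h1
    linarith

/-! ### Asymptotics of the error -/

/-- The error of the coupling at logarithmic depth. -/
theorem eventually_error_le (P : HSBMParams) (c : ℝ) (hc : 0 ≤ c)
    (hcα : c * Real.log P.alpha < 1 / 4) :
    ∀ᶠ n : ℕ in atTop,
      (1 / (n : ℝ) ^ (9 / 20 : ℝ) + (P.errConst + 1) * (n : ℝ) ^ (9 / 20 : ℝ) / n) *
        ((⌊c * Real.log n⌋₊ + 1) * max 1 P.alpha ^ ⌊c * Real.log n⌋₊) ≤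
      (n : ℝ) ^ (-(1 / 5) : ℝ) := by
  have hK := P.errConst_pos
  -- For α < 1 the mean size is still at least 1 because of the root, so the growth exponent is 0
  -- and not c log α.
  set θ : ℝ := c * Real.log (max 1 P.alpha) with hθ
  have hθ4 : θ < 1 / 4 := by
    rcases le_total 1 P.alpha with h | h
    · rw [hθ, max_eq_right h]; exact hcα
    · rw [hθ, max_eq_left h]; norm_num
  -- Since 9/20 = 1/5 + 1/4, the error is n^{-1/5} times a logarithm times n^{-(1/4-θ)}, and this
  -- last power absorbs the logarithm and the constants.
  have hδ : 0 < 1 / 4 - θ := by linarith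
  have ho : (fun x : ℝ => (P.errConst + 2) * (c * Real.log x + 1)) =o[atTop]
      fun x : ℝ => x ^ (1 / 4 - θ) := by
    refine Asymptotics.IsLittleO.const_mul_left (Asymptotics.IsLittleO.add
      ((isLittleO_log_rpow_atTop hδ).const_mul_left c) ?_) _
    rw [Asymptotics.isLittleO_const_left]
    right
    exact tendsto_norm_atTop_atTop.comp (tendsto_rpow_atTop hδ)
  have hev := (ho.bound one_pos).natCast_atTop
  filter_upwards [hev, eventually_ge_atTop 1] with n hn hn1
  have hn1' : (1 : ℝ) ≤ n := by exact_mod_cast hn1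
  have hn0 : (0 : ℝ) < n := by linarith
  have hlog : 0 ≤ Real.log n := Real.log_nonneg hn1'
  rw [one_mul, Real.norm_of_nonneg (by positivity), Real.norm_of_nonneg (by positivity)] at hn
  have hfl : (⌊c * Real.log n⌋₊ : ℝ) ≤ c * Real.log n := Nat.floor_le (by positivity)
  have hmax : (1 : ℝ) ≤ max 1 P.alpha := le_max_left _ _
  have hpow : max 1 P.alpha ^ ⌊c * Real.log n⌋₊ ≤ (n : ℝ) ^ θ := by
    rw [← Real.rpow_natCast, Real.rpow_def_of_pos (by linarith), Real.rpow_def_of_pos hn0]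
    apply Real.exp_le_exp.2
    rw [hθ]
    have := mul_le_mul_of_nonneg_left hfl (Real.log_nonneg hmax)
    linarith
  have h1 : 1 / (n : ℝ) ^ (9 / 20 : ℝ) + (P.errConst + 1) * (n : ℝ) ^ (9 / 20 : ℝ) / n ≤
      (P.errConst + 2) * (n : ℝ) ^ (-(9 / 20) : ℝ) := by
    have e1 : 1 / (n : ℝ) ^ (9 / 20 : ℝ) = (n : ℝ) ^ (-(9 / 20) : ℝ) := by
      rw [Real.rpow_neg hn0.le, one_div]
    have e2 : (n : ℝ) ^ (9 / 20 : ℝ) / n ≤ (n : ℝ) ^ (-(9 / 20) : ℝ) := by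
      rw [← Real.rpow_sub_one hn0.ne']
      exact Real.rpow_le_rpow_of_exponent_le hn1' (by norm_num)
    rw [e1, mul_div_assoc]
    have := mul_le_mul_of_nonneg_left e2 (by linarith : 0 ≤ P.errConst + 1)
    linarith
  calc _ ≤ (P.errConst + 2) * (n : ℝ) ^ (-(9 / 20) : ℝ) *
        ((c * Real.log n + 1) * (n : ℝ) ^ θ) := by gcongr
    _ = (P.errConst + 2) * (c * Real.log n + 1) * ((n : ℝ) ^ (-(9 / 20) : ℝ) * (n : ℝ) ^ θ) := by
        ring
    _ ≤ (n : ℝ) ^ (1 / 4 - θ) * ((n : ℝ) ^ (-(9 / 20) : ℝ) * (n : ℝ) ^ θ) := by gcongr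
    _ = (n : ℝ) ^ (-(1 / 5) : ℝ) := by
        rw [← Real.rpow_add hn0, ← Real.rpow_add hn0]
        congr 1
        ring

/-- The binomial coefficient is at least n/(2(d-1)) by `mul_choose_le`, hence unbounded. The second
condition makes every inclusion probability at most 1/2. -/
theorem eventually_le_choose (P : HSBMParams) :
    ∀ᶠ n : ℕ in atTop, 2 * (P.d - 1) ≤ n ∧ 2 * P.a ≤ n.choose (P.d - 1) := by
  filter_upwards [eventually_ge_atTop (2 * (P.d - 1)),
    tendsto_natCast_atTop_atTop.eventually_ge_atTop (4 * (P.d - 1 : ℕ) * P.a)] with n hn hna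
  refine ⟨hn, ?_⟩
  have h1 := mul_choose_le (r := P.d - 1) P.one_le_d_sub_one hn
  have h2 : 1 ≤ n.choose (P.d - 1 - 1) := Nat.choose_pos (by omega)
  have h3 : n ≤ 2 * (P.d - 1) * n.choose (P.d - 1) := le_trans (by nlinarith) h1
  have h4 : (n : ℝ) ≤ 2 * (P.d - 1 : ℕ) * n.choose (P.d - 1) := by exact_mod_cast h3
  have h5 : (0 : ℝ) < (P.d - 1 : ℕ) := by exact_mod_cast P.one_le_d_sub_one
  have h6 : 2 * (P.d - 1 : ℕ) * (2 * P.a) ≤ 2 * (P.d - 1 : ℕ) * (n.choose (P.d - 1) : ℝ) := by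
    linarith
  exact le_of_mul_le_mul_left h6 (by positivity)

end HSBMParams

theorem mainTheorem5 (P : HSBMParams) (c : ℝ) (hc : 0 ≤ c) (hcα : c * Real.log P.alpha < 1 / 4) :
    ∀ᶠ n : ℕ in atTop, ∀ i : Fin n, ∀ s : ℤˣ,
      ∃ π : Measure (P.Sample n × P.Growth),
        IsCoupling π (ProbabilityTheory.cond (P.hsbmLaw n) {x | x.2 i = s}) P.growthLaw ∧
        ∃ G : Set (P.Sample n × P.Growth), MeasurableSet G ∧
          (∀ z ∈ G, SpinIso ((P.sampleGraph z.1 i).truncate ⌊c * Real.log n⌋₊)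
            ((P.treeGraph s z.2).truncate ⌊c * Real.log n⌋₊)) ∧
          1 - (n : ℝ) ^ (-(1 / 5) : ℝ) ≤ π.real G := by
  filter_upwards [P.eventually_error_le c hc hcα, P.eventually_le_choose] with n herr hn i s
  have hn0 : (0 : ℝ) < n := by exact_mod_cast i.pos
  obtain ⟨π, hπ, G, hG, hiso, hmass⟩ := P.exists_isCoupling ⌊c * Real.log n⌋₊ i s hn.1 hn.2
    (Real.rpow_pos_of_pos hn0 (9 / 20))
  exact ⟨π, hπ, G, hG, hiso, by linarith⟩
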